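/- Setting. Let $X$ be a surface word: a cyclic arrangement of the symbols $s_1,\dots,s_g,S_1,\dots,S_g$, each occurring once ($s_r$ and $S_r$ are called inverse). Label every other edge of a strictly convex $4g$-gon clockwise by $X$, and glue the edges $s_r$ and $S_r$ affinely and orientation-reversingly; this gives an oriented surface $M$ with boundary. Let $W$ be a reduced cyclic word of length $n\ge 1$ in these symbols. A segmented representative of $W$ is a closed curve $f:S^1=\mathbb R/n\mathbb Z\to M$ that consists of $n$ line segments in the polygon joining distinct interior points of labelled edges, each segment starting at the point glued to the end of the preceding one, and leaving the polygon through the edges spelled by $W$. Its point list $P$ is the list of the (labelled) endpoints in clockwise order around the polygon, starting at the beginning of an edge; its segment list is the cyclic list $C=W_0W_1\cdots W_{n-1}$ of the pairs $W_i=(w_{i_1},w_{i_2})$ of initial and final points of the segments (indices mod $n$). Two word segments intersect if the endpoints of one separate those of the other in the cyclic list $P$. A combinatorial bigon $W_{k\dots i},W_{l\dots j}$ of length $L$, $2\le L\le n$, consists of the two sequences (legs) $W_k,W_{k+1},\dots,W_i$ and $W_l,W_{l\pm1},\dots,W_j$ with $i=k+L-1$, $j=l\pm(L-1)$ (one sign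 throughout) such that $W_k$ intersects $W_l$ and $W_i$ intersects $W_j$; $W_{k+m}$ does not intersect $W_{l\pm m}$ for $0<m<L-1$; and for $0\le m<L-1$ the two segments $W_{k+m}$ and $W_{l\pm m}$, traced in the direction of the legs, leave the polygon through the same edge. In a segmented representative with lists $P$ and $C$, the corresponding geometric bigon is the pair of closed subarcs $A_1,A_2$ of $S^1$ which $f$ maps along the segments of the first and of the second leg, from the crossing of $W_k$ with $W_l$ to the crossing of $W_i$ with $W_j$. In general two closed subarcs $A_1,A_2$ of $S^1$ form a bigon if their endpoints have the same images under $f$ and suitable lifts of $f|_{A_1}$ and $f|_{A_2}$ to the universal cover of $M$, with common endpoints, together form the boundary of an embedded closed disk; the bigon is improper if $A_1\cap A_2\neq\emptyset$. Theorem. Let $W_{k\dots i},W_{l\dots j}$ be a combinatorial bigon, and suppose that one of the following holds: 1. at least two word segments are shared by both legs; 2. exactly one word segment is shared by both legs, it is $W_k=W_j$, the point $w_{l_1}$ lies between $w_{i_1}$ and $w_{k_1}$ in $P$, and $w_{i_2}$ lies between $w_{l_2}$ and $w_{k_2}$ in $P$. (Here $w_{i_1},w_{k_1}$ lie on one edge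 and $w_{l_2},w_{k_2}$ lie on one edge, and betweenness refers to the order of the points along that edge.) Then in every segmented representative with the same $P$ and $C$ the corresponding geometric bigon exists, is a bigon, and is improper. -/

import Mathlib

open Set

/-- The symbols `s_1, …, s_g, S_1, …, S_g`: `(r, true)` is `s_r` and `(r, false)` is `S_r`. -/
abbrev Letter (g : ℕ) : Type := Fin g × Bool

/-- The formal inverse of a symbol: `s_r ↔ S_r`. -/
def Letter.inv {g : ℕ} (x : Letter g) : Letter g := (x.1, !x.2)

/-- A labelled point such as `a_3` or `B_1`: a symbol (the edge on which it lies) and an index. -/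
abbrev LPoint (g : ℕ) : Type := Letter g × ℕ

/-- The inverse of a labelled point: `a_i ↔ A_i`. -/
def LPoint.inv {g : ℕ} (p : LPoint g) : LPoint g := (Letter.inv p.1, p.2)

/-- A surface word `X`, a reduced cyclic word `W` of length `n`, a point list `P` and a segment
list `C`. -/
structure CurveCode (g n : ℕ) where
  /-- the surface word, clockwise; every symbol appears exactly once -/
  X : Fin (2 * g) ≃ Letter g
  /-- the cyclic word -/
  W : ZMod n → Letter g
  reduced : ∀ i, W (i + 1) ≠ (W i).inv
  /-- the point list, read clockwise from the beginning of the first edge of `X` -/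
  P : List (LPoint g)
  nodup : P.Nodup
  /-- the edges follow each other in the order given by `X` -/
  edges : ∀ p ∈ P, ∀ q ∈ P, X.symm p.1 < X.symm q.1 → P.idxOf p < P.idxOf q
  inv_mem : ∀ p ∈ P, p.inv ∈ P
  /-- paired edges carry paired points in opposite clockwise order -/
  mates : ∀ p ∈ P, ∀ q ∈ P, p.1 = q.1 → P.idxOf p < P.idxOf q → P.idxOf q.inv < P.idxOf p.inv
  /-- the segment list; `C i = (w_{i1}, w_{i2})` -/
  C : ZMod n → LPoint g × LPoint g
  /-- the endpoints of the segments are exactly the points of `P` -/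
  mem_iff : ∀ p, p ∈ P ↔ ∃ i, p = (C i).1 ∨ p = (C i).2
  /-- every point is used only once -/
  fst_inj : ∀ i j, (C i).1 = (C j).1 → i = j
  snd_inj : ∀ i j, (C i).2 = (C j).2 → i = j
  fst_ne_snd : ∀ i j, (C i).1 ≠ (C j).2
  /-- a segment begins at the point glued to the end of the preceding one -/
  next : ∀ i, (C (i + 1)).1 = (C i).2.inv
  /-- the curve leaves the polygon through the edges spelled by `W` -/
  word : ∀ i, (C i).2.1 = W i

namespace CurveCode

variable {g n : ℕ} (D : CurveCode g n)

/-- The word segment `W_k`, the index being read modulo `n`. -/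
def seg (k : ℤ) : LPoint g × LPoint g := D.C (k : ZMod n)

/-- `z` lies between `x` and `y` in the list `P`. -/
def Between (x y z : LPoint g) : Prop :=
  min (D.P.idxOf x) (D.P.idxOf y) < D.P.idxOf z ∧
    D.P.idxOf z < max (D.P.idxOf x) (D.P.idxOf y)

/-- `W_i I W_j`: the endpoints of `W_i` separate those of `W_j` in the cyclic list `P`. -/
def Crosses (i j : ℤ) : Prop :=
  Xor (D.Between (D.seg i).1 (D.seg i).2 (D.seg j).1)
    (D.Between (D.seg i).1 (D.seg i).2 (D.seg j).2)

end CurveCode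

/-- The index of the segment of the second leg after `m` steps: `l + m` for orientation `(+,+)`
(`rev = false`) and `l - m` for orientation `(+,-)` (`rev = true`). -/
def legIdx (rev : Bool) (l m : ℤ) : ℤ := if rev then l - m else l + m

/-- The endpoint through which a segment is left when it is traced forwards or in reverse. -/
def exitPt {g : ℕ} (rev : Bool) (s : LPoint g × LPoint g) : LPoint g := if rev then s.1 else s.2

namespace CurveCode

variable {g n : ℕ} (D : CurveCode g n)

/-- The pair of sequences `W_k, W_{k+1}, …, W_i` and `W_l, W_{l±1}, …, W_j` of length `L`
(so `i = k + (L-1)`, `j = l ± (L-1)`) is a combinatorial bigon: the first pair of segments and the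
last pair intersect, no pair in between does, and no pair before the last one splits to different
edges of the polygon. -/
structure IsCombBigon (rev : Bool) (k l : ℤ) (L : ℕ) : Prop where
  two_le : 2 ≤ L
  le : L ≤ n
  first : D.Crosses k l
  last : D.Crosses (k + ((L : ℤ) - 1)) (legIdx rev l ((L : ℤ) - 1))
  mid : ∀ m : ℕ, 0 < m → m + 1 < L → ¬ D.Crosses (k + m) (legIdx rev l m)
  nosplit : ∀ m : ℕ, m + 1 < L →
    (D.seg (k + m)).2.1 = (exitPt rev (D.seg (legIdx rev l m))).1

/-- The word segments that occur in both combinatorial legs. -/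
def shared (rev : Bool) (k l : ℤ) (L : ℕ) : Finset (LPoint g × LPoint g) :=
  (Finset.range L).image (fun m : ℕ => D.seg (k + m)) ∩
    (Finset.range L).image (fun m : ℕ => D.seg (legIdx rev l m))

end CurveCode

/-- A strictly convex polygon in the plane with `N` vertices, listed clockwise: every other vertex
lies strictly to the right of the line from `vertex i` to `vertex (i + 1)`. -/
structure ConvexPolygon (N : ℕ) where
  vertex : ZMod N → ℝ × ℝ
  convex : ∀ i j, j ≠ i → j ≠ i + 1 →
    ((vertex (i + 1)).1 - (vertex i).1) * ((vertex j).2 - (vertex i).2) -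
      ((vertex (i + 1)).2 - (vertex i).2) * ((vertex j).1 - (vertex i).1) < 0

/-- The region bounded by the polygon. -/
def ConvexPolygon.region {N : ℕ} (Q : ConvexPolygon N) : Set (ℝ × ℝ) :=
  convexHull ℝ (range Q.vertex)

/-- The edge labelled by the symbol `x`, parametrized clockwise and affinely by `[0,1]`. The
`i`-th symbol of `X` labels the edge from vertex `2i` to vertex `2i+1`; the edges from `2i+1` to
`2i+2` are unlabelled. -/
noncomputable def edgePt {g : ℕ} (X : Fin (2 * g) ≃ Letter g) (Q : ConvexPolygon (4 * g))
    (x : Letter g) (u : ℝ) : ℝ × ℝ :=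
  AffineMap.lineMap (Q.vertex ((2 * (X.symm x : ℕ) : ℕ) : ZMod (4 * g)))
    (Q.vertex ((2 * (X.symm x : ℕ) + 1 : ℕ) : ZMod (4 * g))) u

theorem edgePt_mem {g : ℕ} (X : Fin (2 * g) ≃ Letter g) (Q : ConvexPolygon (4 * g))
    (x : Letter g) {u : ℝ} (hu : u ∈ Icc (0 : ℝ) 1) : edgePt X Q x u ∈ Q.region :=
  (convex_convexHull ℝ _).lineMap_mem (subset_convexHull ℝ _ (mem_range_self _))
    (subset_convexHull ℝ _ (mem_range_self _)) hu

/-- The surface: the polygon with the edges `x` and `x⁻¹` identified, one being traversed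
clockwise and the other counterclockwise. -/
abbrev Surface {g : ℕ} (X : Fin (2 * g) ≃ Letter g) (Q : ConvexPolygon (4 * g)) : Type :=
  Quot (fun p q : Q.region => ∃ (x : Letter g) (u : ℝ), u ∈ Icc (0 : ℝ) 1 ∧
    p.1 = edgePt X Q x u ∧ q.1 = edgePt X Q x.inv (1 - u))

/-- The universal cover of the surface: copies of the polygon indexed by the free group on
`s_1, …, s_g` (the fundamental group), where leaving the copy `h` through the edge `x` leads into
the copy `h * x`, through its edge `x⁻¹`. -/
abbrev UnivCover {g : ℕ} (X : Fin (2 * g) ≃ Letter g) (Q : ConvexPolygon (4 * g)) : Type :=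
  Quot (fun p q : (Σ _ : FreeGroup (Fin g), Q.region) => ∃ (x : Letter g) (u : ℝ),
    u ∈ Icc (0 : ℝ) 1 ∧ q.1 = p.1 * FreeGroup.mk [x] ∧
    p.2.1 = edgePt X Q x u ∧ q.2.1 = edgePt X Q x.inv (1 - u))

/-- The covering projection. -/
def UnivCover.proj {g : ℕ} (X : Fin (2 * g) ≃ Letter g) (Q : ConvexPolygon (4 * g)) :
    UnivCover X Q → Surface X Q :=
  Quot.map Sigma.snd (fun _ _ ⟨x, u, hu, _, h₁, h₂⟩ => ⟨x, u, hu, h₁, h₂⟩)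

/-- A segmented representative with surface word, point list and segment list as in `D`: a polygon
and a position `pos p` (measured clockwise) of each point `p` of `P` on its edge, such that the
points on each edge are in the order of `P` and paired points are identified. -/
structure SegRep {g n : ℕ} (D : CurveCode g n) where
  Q : ConvexPolygon (4 * g)
  pos : LPoint g → ℝ
  pos_mem : ∀ p ∈ D.P, pos p ∈ Ioo (0 : ℝ) 1
  pos_lt : ∀ p ∈ D.P, ∀ q ∈ D.P, p.1 = q.1 → D.P.idxOf p < D.P.idxOf q → pos p < pos q
  pos_inv : ∀ p ∈ D.P, pos p.inv = 1 - pos p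

namespace SegRep

variable {g n : ℕ} {D : CurveCode g n} (R : SegRep D)

/-- The place of a labelled point in the plane. -/
noncomputable def place (p : LPoint g) : ℝ × ℝ := edgePt D.X R.Q p.1 (R.pos p)

theorem place_mem {p : LPoint g} (hp : p ∈ D.P) : R.place p ∈ R.Q.region :=
  edgePt_mem _ _ _ (Ioo_subset_Icc_self (R.pos_mem p hp))

/-- The point of the polygon at time `t`: on `[k, k+1)` the line segment from `w_{k1}` to
`w_{k2}` is traversed. -/
noncomputable def point (t : ℝ) : R.Q.region :=
  ⟨AffineMap.lineMap (R.place (D.seg ⌊t⌋).1) (R.place (D.seg ⌊t⌋).2) (Int.fract t),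
    (convex_convexHull ℝ _).lineMap_mem
      (R.place_mem ((D.mem_iff _).2 ⟨_, Or.inl rfl⟩))
      (R.place_mem ((D.mem_iff _).2 ⟨_, Or.inr rfl⟩))
      ⟨Int.fract_nonneg t, (Int.fract_lt_one t).le⟩⟩

theorem point_periodic : Function.Periodic R.point (n : ℝ) := by
  intro t
  have h1 : ⌊t + (n : ℝ)⌋ = ⌊t⌋ + n := Int.floor_add_natCast t n
  have h2 : Int.fract (t + (n : ℝ)) = Int.fract t := Int.fract_add_natCast t n
  have h3 : D.seg (⌊t⌋ + n) = D.seg ⌊t⌋ := by simp [CurveCode.seg]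
  apply Subtype.ext
  simp only [point, h1, h2, h3]

/-- The representative as a map from the circle `ℝ / nℤ` to the surface. -/
noncomputable def curve : AddCircle (n : ℝ) → Surface D.X R.Q :=
  Function.Periodic.lift (f := fun t => Quot.mk _ (R.point t))
    (fun t => congrArg (Quot.mk _) (R.point_periodic t))

end SegRep

/-- The closed subarc of the circle `ℝ / nℤ` swept out between the times `a` and `b`. -/
def circleArc (n : ℕ) (a b : ℝ) : Set (AddCircle (n : ℝ)) :=
  (fun t : ℝ => (t : AddCircle (n : ℝ))) '' uIcc a b

namespace SegRep

variable {g n : ℕ} {D : CurveCode g n} (R : SegRep D)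

/-- The closed subarcs from `a` to `b` and from `c` to `d` form a bigon of the curve: the endpoints
have the same images, and for suitable lifts of the two arcs to the universal cover, with common
endpoints, the images of the lifts form the boundary of an embedded closed disk. The times `a`,
`b` (and `c`, `d`) may come in either order, according to the direction in which the arc is
traced. -/
def IsBigon (a b c d : ℝ) : Prop :=
  (a ≠ b ∧ |b - a| < n) ∧ (c ≠ d ∧ |d - c| < n) ∧
  R.curve (a : AddCircle (n : ℝ)) = R.curve (c : AddCircle (n : ℝ)) ∧
  R.curve (b : AddCircle (n : ℝ)) = R.curve (d : AddCircle (n : ℝ)) ∧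
  ∃ γ δ : ℝ → UnivCover D.X R.Q,
    ContinuousOn γ (uIcc a b) ∧
    (∀ t ∈ uIcc a b, UnivCover.proj D.X R.Q (γ t) = R.curve (t : AddCircle (n : ℝ))) ∧
    ContinuousOn δ (uIcc c d) ∧
    (∀ t ∈ uIcc c d, UnivCover.proj D.X R.Q (δ t) = R.curve (t : AddCircle (n : ℝ))) ∧
    γ a = δ c ∧ γ b = δ d ∧
    ∃ φ : Metric.closedBall (0 : ℂ) 1 → UnivCover D.X R.Q,
      Continuous φ ∧ Function.Injective φ ∧
      φ '' {z | ‖(z : ℂ)‖ = 1} = γ '' uIcc a b ∪ δ '' uIcc c d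

/-- The two closed subarcs form a bigon and are not disjoint. -/
def IsImproperBigon (a b c d : ℝ) : Prop :=
  R.IsBigon a b c d ∧ ¬ Disjoint (circleArc n a b) (circleArc n c d)

/-- The arcs from `a` to `b` and from `c` to `d` are those traced out by the combinatorial bigon
`W_{k…i}, W_{l…j}`: the first one runs along the line segments `W_k, …, W_i` and the second one
along `W_l, …, W_j`, from the intersection point of the line segments `W_k` and `W_l` to that of
`W_i` and `W_j`. -/
structure Traces (rev : Bool) (k l : ℤ) (L : ℕ) (a b c d : ℝ) : Prop where
  a_mem : a ∈ Ioo (k : ℝ) (k + 1)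
  b_mem : b ∈ Ioo ((k + ((L : ℤ) - 1) : ℤ) : ℝ) ((k + ((L : ℤ) - 1) : ℤ) + 1)
  c_mem : c ∈ Ioo (l : ℝ) (l + 1)
  d_mem : d ∈ Ioo ((legIdx rev l ((L : ℤ) - 1) : ℤ) : ℝ) ((legIdx rev l ((L : ℤ) - 1) : ℤ) + 1)
  first : R.point a = R.point c
  last : R.point b = R.point d

end SegRep

/-! Separation in the cyclic list `P` decides the side of a chord, because the points of `P` occur
in clockwise order on a convex polygon (`SegRep.orient_place_mul`). Hence segments that intersect
combinatorially are chords with exactly one common point, and the two crossings that bound the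
geometric bigon exist.

The bigon property does not depend on the overlap hypotheses. Before their last segments the two
legs leave the polygon through the same edges, so their lifts with common initial point run through
the same copies of the polygon in the universal cover. In the first and the last copy they cut off a
triangle, with its apex at a crossing and its base on a glued edge; in every copy between they do
not cross and bound a convex quadrilateral. Parametrized by slices of a trapezoid, these pieces fit
together along the glued edges. The resulting map is injective because the word is reduced: the
copies along it are distinct and only consecutive ones meet. A trapezoid is a disk, and its bottom
and its top go to the two legs (`Strip.exists_disk`, `SegRep.Traces.isBigon`).

It remains to see that the arcs overlap. If a shared segment is interior to one leg, that arc
contains the whole segment and the other arc meets it. Otherwise a shared segment is the first of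
one leg and the last of the other. Two such segments give `W_k = W_j` and `W_i = W_l`, so both
crossings are the crossing of one pair of chords. If only `W_k = W_j` is available, equally oriented
legs overlap because the betweenness conditions place the crossing with `W_l` before the crossing
with `W_i` on this chord (`crossing_order`). With opposite orientations both arcs contain the final
point of `W_k`. -/

/-! ### Orientation of triples of points in the plane -/

/-- Twice the signed area of the triangle `a b c`; negative if the triangle is clockwise. -/
def orient (a b c : ℝ × ℝ) : ℝ :=
  (b.1 - a.1) * (c.2 - a.2) - (b.2 - a.2) * (c.1 - a.1)

theorem lineMap_fst (a b : ℝ × ℝ) (t : ℝ) :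
    (AffineMap.lineMap a b t : ℝ × ℝ).1 = a.1 + t * (b.1 - a.1) := by
  rw [AffineMap.fst_lineMap, AffineMap.lineMap_apply_ring']; ring

theorem lineMap_snd (a b : ℝ × ℝ) (t : ℝ) :
    (AffineMap.lineMap a b t : ℝ × ℝ).2 = a.2 + t * (b.2 - a.2) := by
  rw [AffineMap.snd_lineMap, AffineMap.lineMap_apply_ring']; ring

theorem orient_rotate (a b c : ℝ × ℝ) : orient b c a = orient a b c := by
  simp only [orient]; ring

theorem orient_swap (a b c : ℝ × ℝ) : orient b a c = -orient a b c := by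
  simp only [orient]; ring

theorem orient_lineMap_left (a b c d : ℝ × ℝ) (t : ℝ) :
    orient (AffineMap.lineMap a b t) c d = (1 - t) * orient a c d + t * orient b c d := by
  simp only [orient, lineMap_fst, lineMap_snd]; ring

theorem orient_lineMap_mid (a b c d : ℝ × ℝ) (t : ℝ) :
    orient c (AffineMap.lineMap a b t) d = (1 - t) * orient c a d + t * orient c b d := by
  simp only [orient, lineMap_fst, lineMap_snd]; ring

theorem orient_lineMap_right (a b c d : ℝ × ℝ) (t : ℝ) :
    orient c d (AffineMap.lineMap a b t) = (1 - t) * orient c d a + t * orient c d b := by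
  simp only [orient, lineMap_fst, lineMap_snd]; ring

theorem orient_lineMap_lineMap (a b c : ℝ × ℝ) (s t : ℝ) :
    orient (AffineMap.lineMap a b s) (AffineMap.lineMap a b t) c = (t - s) * orient a b c := by
  simp only [orient, lineMap_fst, lineMap_snd]; ring

theorem convexComb_neg {p q t : ℝ} (hp : p < 0) (hq : q < 0) (ht : t ∈ Icc (0 : ℝ) 1) :
    (1 - t) * p + t * q < 0 := by
  rcases ht.2.lt_or_eq with h | rfl
  · exact add_neg_of_neg_of_nonpos (mul_neg_of_pos_of_neg (by linarith) hp)
      (mul_nonpos_of_nonneg_of_nonpos ht.1 hq.le)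
  · simpa using hq

theorem convexComb_pos {p q t : ℝ} (hp : 0 < p) (hq : 0 < q) (ht : t ∈ Icc (0 : ℝ) 1) :
    0 < (1 - t) * p + t * q := by
  have := convexComb_neg (neg_neg_of_pos hp) (neg_neg_of_pos hq) ht
  linarith

/-- Transitivity of the angular order in a half plane. -/
theorem orient_trans {o e a b c : ℝ × ℝ} (ha : orient o e a < 0) (hb : orient o e b < 0)
    (hc : orient o e c < 0) (hab : orient o a b < 0) (hbc : orient o b c < 0) :
    orient o a c < 0 := by
  -- This is the three-term Plücker relation for the vectors from `o` to `e`, `a`, `b`, `c`.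
  have key : orient o e b * orient o a c =
      orient o e a * orient o b c + orient o e c * orient o a b := by
    simp only [orient]; ring
  have : 0 < orient o e b * orient o a c := by
    rw [key]; exact add_pos (mul_pos_of_neg_of_neg ha hbc) (mul_pos_of_neg_of_neg hc hab)
  exact neg_of_mul_pos_right this hb.le

/-- An affine function with values `p`, `q` of opposite signs at the ends of a segment vanishes at
the parameter `p / (p - q)`. Applied to the side of each line along the other segment, this gives
both parameters; the two denominators are the determinant of the directions up to sign. -/
theorem exists_crossing {a b c d : ℝ × ℝ} (h₁ : orient a b c * orient a b d < 0)
    (h₂ : orient c d a * orient c d b < 0) :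
    ∃ s ∈ Ioo (0 : ℝ) 1, ∃ t ∈ Ioo (0 : ℝ) 1,
      (AffineMap.lineMap a b s : ℝ × ℝ) = AffineMap.lineMap c d t := by
  have frac : ∀ p q : ℝ, p * q < 0 → p - q ≠ 0 ∧ p / (p - q) ∈ Ioo (0 : ℝ) 1 := by
    intro p q h
    rcases mul_neg_iff.1 h with ⟨hp, hq⟩ | ⟨hp, hq⟩
    · have h0 : 0 < p - q := by linarith
      exact ⟨h0.ne', div_pos hp h0, (div_lt_one h0).2 (by linarith)⟩
    · have h0 : p - q < 0 := by linarith
      exact ⟨h0.ne, div_pos_of_neg_of_neg hp h0, (div_lt_one_of_neg h0).2 (by linarith)⟩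
  obtain ⟨n₁, m₁⟩ := frac _ _ h₁
  obtain ⟨n₂, m₂⟩ := frac _ _ h₂
  refine ⟨_, m₂, _, m₁, ?_⟩
  have e : orient c d a - orient c d b = -(orient a b c - orient a b d) := by
    simp only [orient]; ring
  rw [e] at n₂ ⊢
  apply Prod.ext
  · rw [lineMap_fst, lineMap_fst, div_neg]
    generalize hD : orient a b c - orient a b d = D at n₁ ⊢
    field_simp
    rw [← hD]; simp only [orient]; ring
  · rw [lineMap_snd, lineMap_snd, div_neg]
    generalize hD : orient a b c - orient a b d = D at n₁ ⊢
    field_simp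
    rw [← hD]; simp only [orient]; ring

/-- The difference of the two orientations is the determinant of the directions of the lines. It is
nonzero, so Cramer's rule determines both parameters. -/
theorem crossing_unique {a b c d : ℝ × ℝ} (h : orient a b c * orient a b d < 0) {s t s' t' : ℝ}
    (e : (AffineMap.lineMap a b s : ℝ × ℝ) = AffineMap.lineMap c d t)
    (e' : (AffineMap.lineMap a b s' : ℝ × ℝ) = AffineMap.lineMap c d t') : s = s' ∧ t = t' := by
  have hne : orient a b c - orient a b d ≠ 0 := by
    intro h0; rw [sub_eq_zero.1 h0] at h; exact absurd h (mul_self_nonneg _).not_gt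
  have x := congrArg Prod.fst e
  have y := congrArg Prod.snd e
  have x' := congrArg Prod.fst e'
  have y' := congrArg Prod.snd e'
  simp only [lineMap_fst, lineMap_snd] at x y x' y'
  constructor
  · apply sub_eq_zero.1
    apply (mul_eq_zero.1 _).resolve_right hne
    simp only [orient]
    linear_combination (x - x') * (c.2 - d.2) - (y - y') * (c.1 - d.1)
  · apply sub_eq_zero.1
    apply (mul_eq_zero.1 _).resolve_right hne
    simp only [orient]
    linear_combination (x - x') * (a.2 - b.2) - (y - y') * (a.1 - b.1)

/-! ### Convex polygons -/

namespace ConvexPolygon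

variable {N : ℕ} (Q : ConvexPolygon N)

theorem orient_edge_neg {i j : ZMod N} (h : j ≠ i) (h' : j ≠ i + 1) :
    orient (Q.vertex i) (Q.vertex (i + 1)) (Q.vertex j) < 0 := Q.convex i j h h'

/-- Seen from vertex `i`, all later vertices lie in the half plane of the edge from `i` to `i + 1`,
and each consecutive pair is clockwise by the edge condition. `orient_trans` extends this to
arbitrary pairs. -/
theorem orient_vertex_add_neg (i : ZMod N) {p q : ℕ} (hp : 0 < p) (hpq : p < q) (hq : q < N) :
    orient (Q.vertex i) (Q.vertex (i + p)) (Q.vertex (i + q)) < 0 := by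
  have inj : ∀ a b : ℕ, a < N → b < N → a ≠ b → (i + a : ZMod N) ≠ i + b := by
    intro a b ha hb hab h
    have h' := (ZMod.natCast_eq_natCast_iff' a b N).1 (add_left_cancel h)
    rw [Nat.mod_eq_of_lt ha, Nat.mod_eq_of_lt hb] at h'
    exact hab h'
  have first : ∀ q : ℕ, 1 < q → q < N →
      orient (Q.vertex i) (Q.vertex (i + 1)) (Q.vertex (i + q)) < 0 := by
    intro q h1 h2
    refine Q.orient_edge_neg ?_ ?_
    · simpa using inj q 0 h2 (by omega) (by omega)
    · simpa using inj q 1 h2 (by omega) (by omega)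
  have step : ∀ q : ℕ, 0 < q → q + 1 < N →
      orient (Q.vertex i) (Q.vertex (i + q)) (Q.vertex (i + (q + 1 : ℕ))) < 0 := by
    intro q h1 h2
    rw [← orient_rotate]
    have e : (i + (q + 1 : ℕ) : ZMod N) = i + q + 1 := by push_cast; ring
    rw [e]
    refine Q.orient_edge_neg ?_ ?_
    · simpa using inj 0 q (by omega) (by omega) (by omega)
    · rw [← e]; simpa only [Nat.cast_zero, add_zero] using inj 0 (q + 1) (by omega) h2 (by omega)
  rcases (show p = 1 ∨ 1 < p by omega) with rfl | hp1
  · simpa using first q hpq hq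
  induction q, hpq using Nat.le_induction with
  | base => exact step p hp hq
  | succ q hq' ih =>
    exact orient_trans (first p hp1 (by omega)) (first q (by omega) (by omega))
      (first (q + 1) (by omega) hq) (ih (by omega)) (step q (by omega) hq)

theorem orient_vertex_neg {a b c : ℕ} (hab : a < b) (hbc : b < c) (hc : c < N) :
    orient (Q.vertex (a : ZMod N)) (Q.vertex (b : ZMod N)) (Q.vertex (c : ZMod N)) < 0 := by
  have h := Q.orient_vertex_add_neg (a : ZMod N) (p := b - a) (q := c - a) (by omega) (by omega)
    (by omega)
  rwa [← Nat.cast_add, ← Nat.cast_add, Nat.add_sub_cancel' hab.le,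
    Nat.add_sub_cancel' (hab.trans hbc).le] at h

end ConvexPolygon

/-! ### Labelled edges -/

section Edges

variable {g : ℕ} (X : Fin (2 * g) ≃ Letter g) (Q : ConvexPolygon (4 * g))

theorem Letter.inv_inv (x : Letter g) : x.inv.inv = x := by simp [Letter.inv]

theorem Letter.inv_ne (x : Letter g) : x.inv ≠ x := by
  intro h; have := congrArg Prod.snd h; simp [Letter.inv] at this

/-- The position of `p` relative to the line through the edge `x`; negative inside the polygon. -/
noncomputable def edgeSide (x : Letter g) (p : ℝ × ℝ) : ℝ :=
  orient (edgePt X Q x 0) (edgePt X Q x 1) p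

theorem edgePt_eq_lineMap (x : Letter g) (u : ℝ) :
    edgePt X Q x u = AffineMap.lineMap (edgePt X Q x 0) (edgePt X Q x 1) u := by
  simp [edgePt]

theorem lineMap_edgePt (y : Letter g) (u v t : ℝ) :
    (AffineMap.lineMap (edgePt X Q y u) (edgePt X Q y v) t : ℝ × ℝ) =
      edgePt X Q y (AffineMap.lineMap u v t) := by
  rw [edgePt, edgePt, edgePt]
  exact (AffineMap.apply_lineMap _ _ _ _).symm

theorem edgeSide_lineMap (x : Letter g) (p q : ℝ × ℝ) (t : ℝ) :
    edgeSide X Q x (AffineMap.lineMap p q t) =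
      (1 - t) * edgeSide X Q x p + t * edgeSide X Q x q :=
  orient_lineMap_right _ _ _ _ _

theorem orient_edgePt_edgePt (x : Letter g) (u v : ℝ) (p : ℝ × ℝ) :
    orient (edgePt X Q x u) (edgePt X Q x v) p = (v - u) * edgeSide X Q x p := by
  rw [edgePt_eq_lineMap X Q x u, edgePt_eq_lineMap X Q x v, orient_lineMap_lineMap, edgeSide]

theorem edgeSide_self (x : Letter g) (u : ℝ) : edgeSide X Q x (edgePt X Q x u) = 0 := by
  rw [edgeSide, edgePt_eq_lineMap X Q x u, orient_lineMap_right]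
  simp only [orient]; ring

variable {X}

theorem orient_edgePt_neg {x y z : Letter g} (hxy : X.symm x < X.symm y)
    (hyz : X.symm y < X.symm z) {u v w : ℝ} (hu : u ∈ Icc (0 : ℝ) 1) (hv : v ∈ Icc (0 : ℝ) 1)
    (hw : w ∈ Icc (0 : ℝ) 1) :
    orient (edgePt X Q x u) (edgePt X Q y v) (edgePt X Q z w) < 0 := by
  have h1 : (X.symm x : ℕ) < X.symm y := hxy
  have h2 : (X.symm y : ℕ) < X.symm z := hyz
  have h3 := (X.symm z).isLt
  simp only [edgePt, orient_lineMap_left]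
  simp only [orient_lineMap_mid]
  simp only [orient_lineMap_right]
  refine convexComb_neg (convexComb_neg (convexComb_neg ?_ ?_ hw) (convexComb_neg ?_ ?_ hw) hv)
    (convexComb_neg (convexComb_neg ?_ ?_ hw) (convexComb_neg ?_ ?_ hw) hv) hu <;>
  exact Q.orient_vertex_neg (by omega) (by omega) (by omega)

theorem edgeSide_neg {x y : Letter g} (h : x ≠ y) {u : ℝ} (hu : u ∈ Icc (0 : ℝ) 1) :
    edgeSide X Q x (edgePt X Q y u) < 0 := by
  have h3 := (X.symm x).isLt
  have h4 := (X.symm y).isLt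
  have hne : (X.symm x : ℕ) ≠ X.symm y := fun e => h (X.symm.injective (Fin.ext e))
  simp only [edgeSide, edgePt, AffineMap.lineMap_apply_zero, AffineMap.lineMap_apply_one,
    orient_lineMap_right]
  rcases hne.lt_or_gt with h' | h'
  · exact convexComb_neg (Q.orient_vertex_neg (by omega) (by omega) (by omega))
      (Q.orient_vertex_neg (by omega) (by omega) (by omega)) hu
  · refine convexComb_neg ?_ ?_ hu <;> rw [orient_rotate] <;>
    exact Q.orient_vertex_neg (by omega) (by omega) (by omega)

/-- Unlabelled edges separate the labelled ones, so these do not even share corners. This is why a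
point of the polygon is glued to at most one other point. -/
theorem edgePt_inj {x y : Letter g} {u v : ℝ} (hv : v ∈ Icc (0 : ℝ) 1)
    (h : edgePt X Q x u = edgePt X Q y v) : x = y ∧ u = v := by
  have hxy : x = y := by
    by_contra hne
    have := edgeSide_neg (X := X) Q hne hv
    rw [← h, edgeSide_self] at this
    exact lt_irrefl _ this
  subst hxy
  refine ⟨rfl, ?_⟩
  have h0 := edgeSide_neg (X := X) Q (x.inv_ne).symm (u := 0) (by simp)
  have := orient_edgePt_edgePt X Q x u v (edgePt X Q x.inv 0)
  rw [h] at this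
  have h1 : (v - u) * edgeSide X Q x (edgePt X Q x.inv 0) = 0 := by
    rw [← this]; simp only [orient]; ring
  linarith [(mul_eq_zero.1 h1).resolve_right h0.ne]

end Edges

/-! ### The order of two crossings on a chord -/

/-- Each crossing satisfies `s / (1 - s) = (a S) / (b T)`, and `s / (1 - s)` increases with `s`. The
ratios are compared after cross multiplication, so that only signs of products matter. -/
theorem crossing_ratio_lt {s₁ s₂ a₁ a₂ b₁ b₂ S₁ S₂ T₁ T₂ : ℝ} (hs₁ : s₁ ∈ Ioo (0 : ℝ) 1)
    (hs₂ : s₂ ∈ Ioo (0 : ℝ) 1) (ha : 0 < a₁ * T₂) (ha' : a₁ * T₂ < a₂ * T₁)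
    (hb : 0 < b₂ * S₁) (hb' : b₂ * S₁ < b₁ * S₂)
    (e₁ : (1 - s₁) * (a₁ * S₁) = s₁ * (b₁ * T₁)) (e₂ : (1 - s₂) * (a₂ * S₂) = s₂ * (b₂ * T₂)) :
    s₁ < s₂ := by
  have h1 : (a₁ * T₂) * (b₂ * S₁) < (a₂ * T₁) * (b₁ * S₂) := mul_lt_mul'' ha' hb' ha.le hb.le
  have h2 : (1 - s₁) * s₂ * ((a₁ * T₂) * (b₂ * S₁)) = s₁ * (1 - s₂) * ((a₂ * T₁) * (b₁ * S₂)) := by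
    linear_combination s₂ * b₂ * T₂ * e₁ - s₁ * b₁ * T₁ * e₂
  have h3 : 0 < s₁ * (1 - s₂) := mul_pos hs₁.1 (by linarith [hs₂.2])
  have h4 := mul_lt_mul_of_pos_left h1 h3
  rw [← h2] at h4
  have := lt_of_mul_lt_mul_right h4 (mul_pos ha hb).le
  linarith

/-- Two chords from the edge `x` to the edge `y` that cross a third one: the one that starts closer
to it and ends farther away crosses it first. -/
theorem crossing_order {g : ℕ} {X : Fin (2 * g) ≃ Letter g} (Q : ConvexPolygon (4 * g))
    {x y : Letter g} (hxy : x ≠ y) {α α₁ α₂ β β₁ β₂ : ℝ}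
    (hα : α ∈ Icc (0 : ℝ) 1) (hα₁ : α₁ ∈ Icc (0 : ℝ) 1) (hα₂ : α₂ ∈ Icc (0 : ℝ) 1)
    (hβ : β ∈ Icc (0 : ℝ) 1) (hβ₁ : β₁ ∈ Icc (0 : ℝ) 1) (hβ₂ : β₂ ∈ Icc (0 : ℝ) 1)
    (hα' : α < α₁ ∧ α₁ < α₂ ∨ α₂ < α₁ ∧ α₁ < α) (hβ' : β < β₂ ∧ β₂ < β₁ ∨ β₁ < β₂ ∧ β₂ < β)
    {s₁ s₂ t₁ t₂ : ℝ} (hs₁ : s₁ ∈ Ioo (0 : ℝ) 1) (hs₂ : s₂ ∈ Ioo (0 : ℝ) 1)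
    (e₁ : (AffineMap.lineMap (edgePt X Q x α) (edgePt X Q y β) s₁ : ℝ × ℝ) =
      AffineMap.lineMap (edgePt X Q x α₁) (edgePt X Q y β₁) t₁)
    (e₂ : (AffineMap.lineMap (edgePt X Q x α) (edgePt X Q y β) s₂ : ℝ × ℝ) =
      AffineMap.lineMap (edgePt X Q x α₂) (edgePt X Q y β₂) t₂) : s₁ < s₂ := by
  -- The crossing point is collinear with the ends of the second chord. Its orientation with them is
  -- affine in `s`, and at the two ends of the first chord it is a difference of positions on one
  -- edge times an edge side.
  have key : ∀ {a b s t : ℝ}, (AffineMap.lineMap (edgePt X Q x α) (edgePt X Q y β) s : ℝ × ℝ) =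
      AffineMap.lineMap (edgePt X Q x a) (edgePt X Q y b) t →
      (1 - s) * ((a - α) * edgeSide X Q x (edgePt X Q y b)) =
        s * ((b - β) * edgeSide X Q y (edgePt X Q x a)) := by
    intro a b s t e
    have h0 : orient (edgePt X Q x a) (edgePt X Q y b)
        (AffineMap.lineMap (edgePt X Q x α) (edgePt X Q y β) s) = 0 := by
      rw [e, orient_lineMap_right]; simp only [orient]; ring
    rw [orient_lineMap_right, orient_rotate (edgePt X Q x α), orient_edgePt_edgePt,
      ← orient_rotate (edgePt X Q x a), orient_edgePt_edgePt] at h0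
    linear_combination h0
  have aff : ∀ {x y : Letter g} {a b c : ℝ}, (a - c) * edgeSide X Q y (edgePt X Q x b) -
      (b - c) * edgeSide X Q y (edgePt X Q x a) = edgeSide X Q y (edgePt X Q x c) * (a - b) := by
    intro x y a b c
    rw [edgePt_eq_lineMap X Q x a, edgePt_eq_lineMap X Q x b, edgePt_eq_lineMap X Q x c,
      edgeSide_lineMap, edgeSide_lineMap, edgeSide_lineMap]
    ring
  have k₁ := key e₁
  have k₂ := key e₂
  have fT := aff (x := x) (y := y) (a := α₁) (b := α₂) (c := α)
  have fS := aff (x := y) (y := x) (a := β₂) (b := β₁) (c := β)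
  have T₀ := edgeSide_neg (X := X) Q hxy.symm hα
  have T₁ := edgeSide_neg (X := X) Q hxy.symm hα₁
  have T₂ := edgeSide_neg (X := X) Q hxy.symm hα₂
  have S₀ := edgeSide_neg (X := X) Q hxy hβ
  have S₁ := edgeSide_neg (X := X) Q hxy hβ₁
  have S₂ := edgeSide_neg (X := X) Q hxy hβ₂
  have m₁ : 0 < 1 - s₁ := by linarith [hs₁.2]
  rcases hα' with ⟨ha, ha'⟩ | ⟨ha, ha'⟩ <;> rcases hβ' with ⟨hb, hb'⟩ | ⟨hb, hb'⟩
  · refine crossing_ratio_lt hs₁ hs₂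
      (a₁ := α - α₁) (a₂ := α - α₂) (b₁ := β - β₁) (b₂ := β - β₂)
      (S₁ := edgeSide X Q x (edgePt X Q y β₁)) (S₂ := edgeSide X Q x (edgePt X Q y β₂))
      (T₁ := edgeSide X Q y (edgePt X Q x α₁)) (T₂ := edgeSide X Q y (edgePt X Q x α₂))
      (mul_pos_of_neg_of_neg (by linarith) T₂) ?_ (mul_pos_of_neg_of_neg (by linarith) S₁) ?_
      (by linear_combination -k₁) (by linear_combination -k₂)
    · have := mul_pos_of_neg_of_neg T₀ (sub_neg.2 ha'); linarith
    · have := mul_pos_of_neg_of_neg S₀ (sub_neg.2 hb'); linarith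
  -- Both edges are parametrized clockwise, so chords whose ends are displaced in opposite senses do
  -- not cross.
  · exfalso
    have h1 := mul_neg_of_pos_of_neg m₁ (mul_neg_of_pos_of_neg (sub_pos.2 ha) S₁)
    have h2 := mul_pos hs₁.1 (mul_pos_of_neg_of_neg (sub_neg.2 (hb.trans hb')) T₁)
    linarith
  · exfalso
    have h1 := mul_pos m₁ (mul_pos_of_neg_of_neg (sub_neg.2 ha') S₁)
    have h2 := mul_neg_of_pos_of_neg hs₁.1 (mul_neg_of_pos_of_neg (sub_pos.2 (hb.trans hb')) T₁)
    linarith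
  · refine crossing_ratio_lt hs₁ hs₂
      (a₁ := α₁ - α) (a₂ := α₂ - α) (b₁ := β₁ - β) (b₂ := β₂ - β)
      (S₁ := edgeSide X Q x (edgePt X Q y β₁)) (S₂ := edgeSide X Q x (edgePt X Q y β₂))
      (T₁ := edgeSide X Q y (edgePt X Q x α₁)) (T₂ := edgeSide X Q y (edgePt X Q x α₂))
      (mul_pos_of_neg_of_neg (by linarith) T₂) ?_ (mul_pos_of_neg_of_neg (by linarith) S₁) ?_ k₁ k₂
    · have := mul_neg_of_neg_of_pos T₀ (sub_pos.2 ha); linarith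
    · have := mul_neg_of_neg_of_pos S₀ (sub_pos.2 hb); linarith

/-! ### Cells of the universal cover -/

section Cells

variable {g : ℕ} (X : Fin (2 * g) ≃ Letter g) (Q : ConvexPolygon (4 * g))

theorem ConvexPolygon.vertex_mem_region {N : ℕ} (Q : ConvexPolygon N) (i : ZMod N) :
    Q.vertex i ∈ Q.region := subset_convexHull ℝ _ (mem_range_self i)

theorem ConvexPolygon.convex_region {N : ℕ} (Q : ConvexPolygon N) : Convex ℝ Q.region :=
  convex_convexHull ℝ _

open Classical in
/-- A point of the plane as a point of the polygon; the value is arbitrary outside the polygon. -/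
noncomputable def ConvexPolygon.toRegion {N : ℕ} (Q : ConvexPolygon N) (p : ℝ × ℝ) : Q.region :=
  if hp : p ∈ Q.region then ⟨p, hp⟩ else ⟨Q.vertex 0, Q.vertex_mem_region 0⟩

theorem ConvexPolygon.toRegion_of_mem {N : ℕ} (Q : ConvexPolygon N) {p : ℝ × ℝ}
    (hp : p ∈ Q.region) : Q.toRegion p = ⟨p, hp⟩ := dif_pos hp

theorem ConvexPolygon.continuousOn_toRegion {N : ℕ} (Q : ConvexPolygon N) :
    ContinuousOn Q.toRegion Q.region := by
  rw [continuousOn_iff_continuous_domRestrict]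
  refine continuous_id.congr fun p => ?_
  simp [Q.toRegion_of_mem p.2]

/-- The point of the universal cover that lies over `p` in the copy `h` of the polygon. -/
noncomputable def cell (h : FreeGroup (Fin g)) (p : ℝ × ℝ) : UnivCover X Q :=
  Quot.mk _ ⟨h, Q.toRegion p⟩

/-- The point of the surface represented by a point of the polygon. -/
noncomputable def surfacePt (p : ℝ × ℝ) : Surface X Q := Quot.mk _ (Q.toRegion p)

theorem proj_cell (h : FreeGroup (Fin g)) (p : ℝ × ℝ) :
    UnivCover.proj X Q (cell X Q h p) = surfacePt X Q p := rfl

theorem continuousOn_cell (h : FreeGroup (Fin g)) : ContinuousOn (cell X Q h) Q.region :=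
  (continuous_quot_mk.comp continuous_sigmaMk).comp_continuousOn Q.continuousOn_toRegion

theorem cell_edgePt (h : FreeGroup (Fin g)) (x : Letter g) {u : ℝ} (hu : u ∈ Icc (0 : ℝ) 1) :
    cell X Q h (edgePt X Q x u) =
      cell X Q (h * FreeGroup.mk [x]) (edgePt X Q x.inv (1 - u)) := by
  have hu' : 1 - u ∈ Icc (0 : ℝ) 1 := ⟨by linarith [hu.2], by linarith [hu.1]⟩
  apply Quot.sound
  refine ⟨x, u, hu, rfl, ?_, ?_⟩
  · rw [Q.toRegion_of_mem (edgePt_mem X Q x hu)]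
  · rw [Q.toRegion_of_mem (edgePt_mem X Q x.inv hu')]

theorem surfacePt_edgePt (x : Letter g) {u : ℝ} (hu : u ∈ Icc (0 : ℝ) 1) :
    surfacePt X Q (edgePt X Q x u) = surfacePt X Q (edgePt X Q x.inv (1 - u)) :=
  congrArg (UnivCover.proj X Q) (cell_edgePt X Q 1 x hu)

theorem mk_letter_mul_inv (x : Letter g) :
    FreeGroup.mk [x] * FreeGroup.mk [x.inv] = (1 : FreeGroup (Fin g)) := by
  have : FreeGroup.mk [x.inv] = (FreeGroup.mk [x])⁻¹ := by
    rw [FreeGroup.inv_mk]; rfl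
  rw [this, mul_inv_cancel]

/-- The gluing relation is symmetric, and since labelled edges are disjoint, two successive gluings
lead back to the starting point. The equivalence relation it generates is therefore equality or a
single gluing. -/
theorem cell_eq_cell {h h' : FreeGroup (Fin g)} {p p' : ℝ × ℝ} (hp : p ∈ Q.region)
    (hp' : p' ∈ Q.region) (e : cell X Q h p = cell X Q h' p') :
    (h = h' ∧ p = p') ∨ ∃ (x : Letter g) (u : ℝ), u ∈ Icc (0 : ℝ) 1 ∧
      h' = h * FreeGroup.mk [x] ∧ p = edgePt X Q x u ∧ p' = edgePt X Q x.inv (1 - u) := by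
  let r := fun p q : (Σ _ : FreeGroup (Fin g), Q.region) => ∃ (x : Letter g) (u : ℝ),
    u ∈ Icc (0 : ℝ) 1 ∧ q.1 = p.1 * FreeGroup.mk [x] ∧
    p.2.1 = edgePt X Q x u ∧ q.2.1 = edgePt X Q x.inv (1 - u)
  have symm : ∀ a b, r a b → r b a := by
    rintro a b ⟨x, u, hu, h1, h2, h3⟩
    refine ⟨x.inv, 1 - u, ⟨by linarith [hu.2], by linarith [hu.1]⟩, ?_, h3, ?_⟩
    · rw [h1, mul_assoc, mk_letter_mul_inv, mul_one]
    · rw [h2, x.inv_inv, sub_sub_cancel]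
  have trans : ∀ a b c, r a b → r b c → a = c := by
    rintro ⟨a, p⟩ b ⟨c, q⟩ ⟨x, u, hu, h1, h2, h3⟩ ⟨y, v, hv, k1, k2, k3⟩
    obtain ⟨rfl, huv⟩ := edgePt_inj Q hv (h3.symm.trans k2)
    rw [x.inv_inv] at k3
    have hq : p = q := by
      apply Subtype.ext
      rw [show p.1 = _ from h2, show q.1 = _ from k3, ← huv, sub_sub_cancel]
    subst hq
    simp only at k1 h1
    rw [h1, mul_assoc, mk_letter_mul_inv, mul_one] at k1
    rw [k1]
  have key : ∀ a b, Relation.EqvGen r a b → a = b ∨ r a b := by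
    intro a b hab
    induction hab with
    | rel a b h => exact Or.inr h
    | refl a => exact Or.inl rfl
    | symm a b _ ih => exact ih.imp Eq.symm (symm a b)
    | trans a b c _ _ ih ih' =>
      rcases ih with rfl | ih
      · exact ih'
      · rcases ih' with rfl | ih'
        · exact Or.inr ih
        · exact Or.inl (trans a b c ih ih')
  have := key _ _ (Quot.eqvGen_exact e)
  rw [Q.toRegion_of_mem hp, Q.toRegion_of_mem hp'] at this
  rcases this with h1 | h1
  · left
    obtain ⟨h2, h3⟩ := Sigma.mk.inj h1
    exact ⟨h2, congrArg Subtype.val (eq_of_heq h3)⟩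
  · exact Or.inr h1

theorem cell_injOn (h : FreeGroup (Fin g)) : InjOn (cell X Q h) Q.region := by
  intro p hp p' hp' e
  rcases cell_eq_cell X Q hp hp' e with h' | ⟨y, u, -, h', -⟩
  · exact h'.2
  · have h1 : FreeGroup.mk [y] = 1 := left_eq_mul.1 h'
    rw [FreeGroup.one_eq_mk] at h1
    have h2 := FreeGroup.reduce.sound h1
    rw [FreeGroup.IsReduced.singleton.reduce_eq, FreeGroup.IsReduced.nil.reduce_eq] at h2
    simp at h2

end Cells

/-! ### Reduced words -/

section Words

variable {g : ℕ}

/-- The group element spelled by the first `m` letters of a sequence. -/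
def wordElt (x : ℕ → Letter g) (m : ℕ) : FreeGroup (Fin g) :=
  FreeGroup.mk ((List.range m).map x)

theorem wordElt_succ (x : ℕ → Letter g) (m : ℕ) :
    wordElt x (m + 1) = wordElt x m * FreeGroup.mk [x m] := by
  simp [wordElt, List.range_succ, FreeGroup.mul_mk]

theorem wordElt_add (x : ℕ → Letter g) (m r : ℕ) :
    wordElt x (m + r) = wordElt x m * wordElt (fun i => x (m + i)) r := by
  induction r with
  | zero => simp [wordElt]
  | succ r ih => rw [← add_assoc, wordElt_succ, ih, wordElt_succ, mul_assoc]

theorem Letter.eq_inv_iff {x y : Letter g} : y = x.inv ↔ x.1 = y.1 ∧ x.2 ≠ y.2 := by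
  obtain ⟨a, b⟩ := x
  obtain ⟨c, d⟩ := y
  cases b <;> cases d <;> simp [Letter.inv, eq_comm]

theorem isReduced_map_range {x : ℕ → Letter g} {r : ℕ}
    (h : ∀ m, m + 1 < r → x (m + 1) ≠ (x m).inv) :
    FreeGroup.IsReduced ((List.range r).map x) := by
  rw [FreeGroup.IsReduced, List.isChain_iff_getElem]
  intro i hi
  simp only [List.length_map, List.length_range] at hi
  have := h i hi
  rw [Ne, Letter.eq_inv_iff] at this
  simp only [List.getElem_map, List.getElem_range]
  tauto

/-- An element of a free group has only one reduced word. -/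
theorem wordElt_eq_mk {x : ℕ → Letter g} {r : ℕ}
    (h : ∀ m, m + 1 < r → x (m + 1) ≠ (x m).inv) {l : List (Letter g)}
    (hl : FreeGroup.IsReduced l) (e : wordElt x r = FreeGroup.mk l) :
    (List.range r).map x = l := by
  have := FreeGroup.reduce.sound e
  rwa [(isReduced_map_range h).reduce_eq, hl.reduce_eq] at this

/-- The cells along a reduced word are pairwise distinct. -/
theorem wordElt_injOn {x : ℕ → Letter g} {L : ℕ}
    (h : ∀ m, m + 2 < L → x (m + 1) ≠ (x m).inv) {m m' : ℕ} (hlt : m < m') (hm' : m' < L) :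
    wordElt x m ≠ wordElt x m' := by
  obtain ⟨r, rfl⟩ := Nat.exists_eq_add_of_lt hlt
  rw [add_assoc, wordElt_add]
  intro e
  have := wordElt_eq_mk (x := fun i => x (m + i)) (r := r + 1) (l := [])
    (fun i hi => h (m + i) (by omega)) FreeGroup.IsReduced.nil
    (by rw [← FreeGroup.one_eq_mk]; exact (mul_eq_left.1 e.symm))
  simp at this

/-- Along a reduced word only consecutive cells are adjacent. -/
theorem wordElt_adjacent {x : ℕ → Letter g} {L : ℕ}
    (h : ∀ m, m + 2 < L → x (m + 1) ≠ (x m).inv) {m m' : ℕ} (hlt : m < m') (hm' : m' < L)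
    {y : Letter g} (e : wordElt x m' = wordElt x m * FreeGroup.mk [y]) :
    m' = m + 1 ∧ y = x m := by
  obtain ⟨r, rfl⟩ := Nat.exists_eq_add_of_lt hlt
  rw [add_assoc, wordElt_add] at e
  have := wordElt_eq_mk (x := fun i => x (m + i)) (r := r + 1) (l := [y])
    (fun i hi => h (m + i) (by omega)) FreeGroup.IsReduced.singleton (mul_left_cancel e)
  have hr : r = 0 := by simpa using congrArg List.length this
  subst hr
  simp at this
  exact ⟨rfl, this.symm⟩

end Words

/-! ### Gluing a finite sequence of maps -/

section Gluing

variable {α Y : Type*}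

/-- The map given by `c m` where the clock `κ` runs from `m` to `m + 1`, for `m < L`. -/
noncomputable def glued (c : ℕ → α → Y) (κ : α → ℝ) (L : ℕ) (z : α) : Y :=
  -- The minimum serves the final clock value `L`, whose floor lies past the last piece.
  c (min ⌊κ z⌋₊ (L - 1)) z

/-- At an integer clock value the floor selects the later piece; the agreement hypothesis makes the
formula valid on closed intervals, as pasting requires. -/
theorem glued_eq {c : ℕ → α → Y} {κ : α → ℝ} {L : ℕ} {s : Set α}
    (hc : ∀ m, m + 1 < L → ∀ z ∈ s, κ z = m + 1 → c m z = c (m + 1) z) {m : ℕ} (hm : m < L)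
    {z : α} (hz : z ∈ s) (hκ : κ z ∈ Icc (m : ℝ) (m + 1)) : glued c κ L z = c m z := by
  rcases hκ.2.lt_or_eq with h | h
  · have : ⌊κ z⌋₊ = m := (Nat.floor_eq_iff ((Nat.cast_nonneg m).trans hκ.1)).2 ⟨hκ.1, h⟩
    rw [glued, this, min_eq_left (by omega)]
  · have : ⌊κ z⌋₊ = m + 1 := by rw [h]; exact_mod_cast Nat.floor_natCast (m + 1)
    rw [glued, this]
    rcases (show m + 1 < L ∨ m + 1 = L by omega) with h' | h'
    · rw [min_eq_left (by omega), hc m h' z hz h]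
    · rw [min_eq_right (by omega), ← h', Nat.add_sub_cancel]

theorem exists_mem_Icc_nat {L : ℕ} {t : ℝ} (hL : 0 < L) (ht : t ∈ Icc (0 : ℝ) L) :
    ∃ m < L, t ∈ Icc (m : ℝ) (m + 1) := by
  rcases ht.2.lt_or_eq with h | h
  · exact ⟨⌊t⌋₊, (Nat.floor_lt ht.1).2 h, Nat.floor_le ht.1, (Nat.lt_floor_add_one t).le⟩
  · refine ⟨L - 1, by omega, ?_⟩
    rw [h, Nat.cast_sub hL]
    simp

theorem continuousOn_glued [TopologicalSpace α] [TopologicalSpace Y] {c : ℕ → α → Y}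
    {κ : α → ℝ} {L : ℕ} {s : Set α} (hL : 0 < L)
    (hs : IsClosed s) (hκ : Continuous κ) (hsκ : ∀ z ∈ s, κ z ∈ Icc (0 : ℝ) L)
    (hcont : ∀ m < L, ContinuousOn (c m) (s ∩ κ ⁻¹' Icc (m : ℝ) (m + 1)))
    (hc : ∀ m, m + 1 < L → ∀ z ∈ s, κ z = m + 1 → c m z = c (m + 1) z) :
    ContinuousOn (glued c κ L) s := by
  have hU : s = ⋃ m : Fin L, s ∩ κ ⁻¹' Icc ((m : ℕ) : ℝ) ((m : ℕ) + 1) := by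
    ext z
    simp only [mem_iUnion, mem_inter_iff, mem_preimage]
    refine ⟨fun hz => ?_, fun ⟨_, h, _⟩ => h⟩
    obtain ⟨m, hm, h⟩ := exists_mem_Icc_nat hL (hsκ z hz)
    exact ⟨⟨m, hm⟩, hz, h⟩
  rw [hU]
  refine (locallyFinite_of_finite _).continuousOn_iUnion
    (fun m => hs.inter (isClosed_Icc.preimage hκ)) fun m => ?_
  exact (hcont m m.2).congr fun z hz => glued_eq hc m.2 hz.1 hz.2

end Gluing

/-! ### Triangles and quadrilaterals -/

/-- The affine map that sends `(0,0)`, `(1,0)`, `(1,1)` to `o`, `a`, `b`. -/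
def triMap (o a b : ℝ × ℝ) (x y : ℝ) : ℝ × ℝ := o + (x - y) • (a - o) + y • (b - o)

/-- The bilinear map that sends the corners `(0,0)`, `(0,1)`, `(1,0)`, `(1,1)` of the unit square to
the four given points, in this order. -/
noncomputable def quadMap (a b a' b' : ℝ × ℝ) (x y : ℝ) : ℝ × ℝ :=
  AffineMap.lineMap (AffineMap.lineMap a a' x : ℝ × ℝ) (AffineMap.lineMap b b' x) y

theorem triMap_mem {s : Set (ℝ × ℝ)} (hs : Convex ℝ s) {o a b : ℝ × ℝ} (ho : o ∈ s) (ha : a ∈ s)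
    (hb : b ∈ s) {x y : ℝ} (hy : 0 ≤ y) (hyx : y ≤ x) (hx : x ≤ 1) : triMap o a b x y ∈ s := by
  have h := hs.sum_mem (t := Finset.univ) (w := ![1 - x, x - y, y]) (z := ![o, a, b])
    (fun i _ => by fin_cases i <;> simp <;> linarith)
    (by simp [Fin.sum_univ_three]) (fun i _ => by fin_cases i <;> simpa)
  have e : triMap o a b x y = (1 - x) • o + (x - y) • a + y • b := by
    simp only [triMap]; module
  rw [e]
  simpa [Fin.sum_univ_three] using h

theorem quadMap_mem {s : Set (ℝ × ℝ)} (hs : Convex ℝ s) {a b a' b' : ℝ × ℝ} (ha : a ∈ s)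
    (hb : b ∈ s) (ha' : a' ∈ s) (hb' : b' ∈ s) {x y : ℝ} (hx : x ∈ Icc (0 : ℝ) 1)
    (hy : y ∈ Icc (0 : ℝ) 1) : quadMap a b a' b' x y ∈ s :=
  hs.lineMap_mem (hs.lineMap_mem ha ha' hx) (hs.lineMap_mem hb hb' hx) hy

theorem triMap_zero_right (o a b : ℝ × ℝ) (x : ℝ) :
    triMap o a b x 0 = AffineMap.lineMap o a x := by
  simp [triMap, AffineMap.lineMap_apply, add_comm]

theorem triMap_diag (o a b : ℝ × ℝ) (x : ℝ) : triMap o a b x x = AffineMap.lineMap o b x := by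
  simp [triMap, AffineMap.lineMap_apply, add_comm]

theorem triMap_one_left (o a b : ℝ × ℝ) (y : ℝ) : triMap o a b 1 y = AffineMap.lineMap a b y := by
  simp only [triMap, AffineMap.lineMap_apply, vsub_eq_sub, vadd_eq_add]; module

theorem triMap_inj {o a b : ℝ × ℝ} (h : orient o a b ≠ 0) {x y x' y' : ℝ}
    (e : triMap o a b x y = triMap o a b x' y') : x = x' ∧ y = y' := by
  have e1 := congrArg Prod.fst e
  have e2 := congrArg Prod.snd e
  simp only [triMap, Prod.fst_add, Prod.snd_add, Prod.smul_fst, Prod.smul_snd, Prod.fst_sub,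
    Prod.snd_sub, smul_eq_mul] at e1 e2
  have hy : y = y' := by
    apply sub_eq_zero.1
    apply (mul_eq_zero.1 _).resolve_right h
    simp only [orient]
    linear_combination (a.1 - o.1) * e2 - (a.2 - o.2) * e1
  subst hy
  refine ⟨?_, rfl⟩
  apply sub_eq_zero.1
  apply (mul_eq_zero.1 _).resolve_right h
  simp only [orient]
  linear_combination (b.2 - o.2) * e1 - (b.1 - o.1) * e2

theorem orient_quadMap (a b a' b' : ℝ × ℝ) (x x' y' : ℝ) :
    orient (AffineMap.lineMap a a' x) (AffineMap.lineMap b b' x) (quadMap a b a' b' x' y') =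
      (x - x') * ((1 - y') * ((1 - x) * orient a a' b + x * orient a a' b') +
        y' * ((1 - x) * -orient b b' a + x * -orient b b' a')) := by
  simp only [quadMap, orient, lineMap_fst, lineMap_snd]; ring

/-- The lines `x = const` go to segments. By `orient_quadMap` a point with parameter `x'` is on the
line of parameter `x` only if `x = x'`, as the second factor is nonzero. On one segment `y` is then
determined unless the segment shrinks to a point, which would make that factor vanish. -/
theorem quadMap_inj_aux {a b a' b' : ℝ × ℝ} {x x' y y' : ℝ}
    (h : ((1 - y') * ((1 - x) * orient a a' b + x * orient a a' b') +
        y' * ((1 - x) * -orient b b' a + x * -orient b b' a')) ≠ 0)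
    (e : quadMap a b a' b' x y = quadMap a b a' b' x' y') : x = x' ∧ y = y' := by
  have h0 := orient_quadMap a b a' b' x x' y'
  rw [← e, quadMap, orient_lineMap_right] at h0
  have h1 : (x - x') * ((1 - y') * ((1 - x) * orient a a' b + x * orient a a' b') +
        y' * ((1 - x) * -orient b b' a + x * -orient b b' a')) = 0 := by
    rw [← h0]; simp only [orient]; ring
  have hxx : x = x' := by linarith [(mul_eq_zero.1 h1).resolve_right h]
  subst hxx
  refine ⟨rfl, ?_⟩
  by_contra hne
  have hab : (AffineMap.lineMap a a' x : ℝ × ℝ) = AffineMap.lineMap b b' x := by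
    have := (AffineMap.lineMap_eq_lineMap_iff (k := ℝ)).1 e
    exact this.resolve_right hne
  -- The choice `x' = x - 1` turns the factor `x - x'` into `1`.
  have h2 := orient_quadMap a b a' b' x (x - 1) y'
  rw [hab] at h2
  apply h
  have h3 : orient (AffineMap.lineMap b b' x) (AffineMap.lineMap b b' x)
    (quadMap a b a' b' (x - 1) y') = 0 := by simp only [orient]; ring
  rw [h3] at h2
  linarith

/-- The bilinear map onto a convex quadrilateral is injective. -/
theorem quadMap_inj {a b a' b' : ℝ × ℝ} (h₁ : 0 < orient a a' b * orient a a' b')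
    (h₂ : 0 < orient b b' a * orient b b' a') (h₃ : orient a a' b * orient b b' a < 0)
    {x y x' y' : ℝ} (hx : x ∈ Icc (0 : ℝ) 1)
    (hy' : y' ∈ Icc (0 : ℝ) 1) (e : quadMap a b a' b' x y = quadMap a b a' b' x' y') :
    x = x' ∧ y = y' := by
  refine quadMap_inj_aux ?_ e
  -- The hypotheses give all four corner values the same sign, so their bilinear interpolation has
  -- no zero on the square.
  rcases mul_neg_iff.1 h₃ with ⟨p, q⟩ | ⟨p, q⟩
  · exact (convexComb_pos (convexComb_pos p (pos_of_mul_pos_right h₁ p.le) hx)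
      (convexComb_pos (neg_pos.2 q) (neg_pos.2 (neg_of_mul_pos_right h₂ q.le)) hx) hy').ne'
  · exact (convexComb_neg (convexComb_neg p (neg_of_mul_pos_right h₁ p.le) hx)
      (convexComb_neg (neg_neg_of_pos q) (neg_neg_of_pos (pos_of_mul_pos_right h₂ q.le)) hx)
      hy').ne

theorem edgeSide_triMap {g : ℕ} (X : Fin (2 * g) ≃ Letter g) (Q : ConvexPolygon (4 * g))
    (z : Letter g) (o a b : ℝ × ℝ) (x y : ℝ) : edgeSide X Q z (triMap o a b x y) =
      (1 - x) * edgeSide X Q z o + (x - y) * edgeSide X Q z a + y * edgeSide X Q z b := by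
  simp only [edgeSide, orient, triMap, Prod.fst_add, Prod.snd_add, Prod.smul_fst, Prod.smul_snd,
    Prod.fst_sub, Prod.snd_sub, smul_eq_mul]
  ring

theorem edgeSide_quadMap {g : ℕ} (X : Fin (2 * g) ≃ Letter g) (Q : ConvexPolygon (4 * g))
    (z : Letter g) (a b a' b' : ℝ × ℝ) (x y : ℝ) : edgeSide X Q z (quadMap a b a' b' x y) =
      (1 - x) * ((1 - y) * edgeSide X Q z a + y * edgeSide X Q z b) +
        x * ((1 - y) * edgeSide X Q z a' + y * edgeSide X Q z b') := by
  simp only [quadMap, edgeSide_lineMap]; ring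

theorem continuous_triMap {α : Type*} [TopologicalSpace α] (o a b : ℝ × ℝ) {f h : α → ℝ}
    (hf : Continuous f) (hh : Continuous h) : Continuous fun z => triMap o a b (f z) (h z) := by
  unfold triMap; fun_prop

theorem continuous_quadMap {α : Type*} [TopologicalSpace α] (a b a' b' : ℝ × ℝ) {f h : α → ℝ}
    (hf : Continuous f) (hh : Continuous h) :
    Continuous fun z => quadMap a b a' b' (f z) (h z) := by
  simp only [quadMap, AffineMap.lineMap_apply, vsub_eq_sub, vadd_eq_add]; fun_prop

/-! ### The trapezoid -/

/-- The trapezoid with the vertices `0`, `L`, `L - 1 + i`, `1 + i`. -/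
def trapezoid (L : ℕ) : Set ℂ :=
  {z | 0 ≤ z.im ∧ z.im ≤ 1 ∧ z.im ≤ z.re ∧ z.im ≤ L - z.re}

theorem isClosed_trapezoid (L : ℕ) : IsClosed (trapezoid L) := by
  have h1 := Complex.continuous_im
  have h2 := Complex.continuous_re
  exact (isClosed_le continuous_const h1).inter ((isClosed_le h1 continuous_const).inter
    ((isClosed_le h1 h2).inter (isClosed_le h1 (continuous_const.sub h2))))

theorem convex_trapezoid (L : ℕ) : Convex ℝ (trapezoid L) := by
  rintro z ⟨z1, z2, z3, z4⟩ w ⟨w1, w2, w3, w4⟩ a b ha hb hab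
  simp only [trapezoid, mem_ofPred_eq, Complex.add_im, Complex.add_re, Complex.real_smul,
    Complex.mul_im, Complex.mul_re, Complex.ofReal_re, Complex.ofReal_im, zero_mul, add_zero,
    sub_zero]
  have := mul_le_mul_of_nonneg_left z1 ha
  have := mul_le_mul_of_nonneg_left z2 ha
  have := mul_le_mul_of_nonneg_left z3 ha
  have := mul_le_mul_of_nonneg_left z4 ha
  have := mul_le_mul_of_nonneg_left w1 hb
  have := mul_le_mul_of_nonneg_left w2 hb
  have := mul_le_mul_of_nonneg_left w3 hb
  have := mul_le_mul_of_nonneg_left w4 hb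
  have hL : (L : ℝ) = a * L + b * L := by rw [← add_mul, hab, one_mul]
  refine ⟨?_, ?_, ?_, ?_⟩ <;> linarith

theorem isBounded_trapezoid (L : ℕ) : Bornology.IsBounded (trapezoid L) := by
  refine (Metric.isBounded_closedBall (x := (0 : ℂ)) (r := L + 1)).subset ?_
  rintro z ⟨z1, z2, z3, z4⟩
  rw [mem_closedBall_zero_iff]
  refine (Complex.norm_le_abs_re_add_abs_im z).trans ?_
  rw [abs_of_nonneg (by linarith), abs_of_nonneg z1]
  linarith

theorem mem_interior_trapezoid {L : ℕ} {z : ℂ} (h1 : 0 < z.im) (h2 : z.im < 1)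
    (h3 : z.im < z.re) (h4 : z.im < L - z.re) : z ∈ interior (trapezoid L) := by
  have c1 := Complex.continuous_im
  have c2 := Complex.continuous_re
  have ho : IsOpen {z : ℂ | 0 < z.im ∧ z.im < 1 ∧ z.im < z.re ∧ z.im < L - z.re} :=
    (isOpen_lt continuous_const c1).inter ((isOpen_lt c1 continuous_const).inter
      ((isOpen_lt c1 c2).inter (isOpen_lt c1 (continuous_const.sub c2))))
  have hsub : {z : ℂ | 0 < z.im ∧ z.im < 1 ∧ z.im < z.re ∧ z.im < L - z.re} ⊆ trapezoid L :=
    fun w hw => ⟨hw.1.le, hw.2.1.le, hw.2.2.1.le, hw.2.2.2.le⟩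
  exact interior_maximal hsub ho ⟨h1, h2, h3, h4⟩

/-- The frontier is written as two graphs over `[0, L]`, one for each leg; the slanted sides belong
to the upper graph. An interior point can be moved both up and down, which fails on either graph. -/
theorem frontier_trapezoid (L : ℕ) : frontier (trapezoid L) =
    {z ∈ trapezoid L | z.im = 0 ∨ z.im = min 1 (min z.re (L - z.re))} := by
  have key : ∀ z ∈ interior (trapezoid L), ∃ ε : ℝ, 0 < ε ∧
      z + ε * Complex.I ∈ trapezoid L ∧ z - ε * Complex.I ∈ trapezoid L := by
    intro z hz
    obtain ⟨r, hr, hb⟩ := Metric.isOpen_iff.1 isOpen_interior z hz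
    refine ⟨r / 2, by linarith, interior_subset (hb ?_), interior_subset (hb ?_)⟩ <;>
    simp [abs_of_pos hr, hr]
  rw [(isClosed_trapezoid L).frontier_eq]
  ext z
  refine ⟨fun ⟨hz, hz'⟩ => ⟨hz, ?_⟩, fun ⟨hz, hz'⟩ => ⟨hz, fun hi => ?_⟩⟩
  · by_contra hcon
    push Not at hcon
    obtain ⟨z1, z2, z3, z4⟩ := hz
    have hlt := lt_of_le_of_ne (le_min z2 (le_min z3 z4)) hcon.2
    simp only [lt_min_iff] at hlt
    exact hz' (mem_interior_trapezoid (lt_of_le_of_ne z1 (Ne.symm hcon.1)) hlt.1 hlt.2.1 hlt.2.2)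
  · obtain ⟨ε, hε, ⟨a1, a2, a3, a4⟩, ⟨b1, b2, b3, b4⟩⟩ := key z hi
    simp at a1 a2 a3 a4 b1 b2 b3 b4
    rcases hz' with h | h
    · linarith
    · have : z.im + ε ≤ min 1 (min z.re (L - z.re)) := le_min a2 (le_min a3 a4)
      linarith

/-- A homeomorphism of the plane that takes the trapezoid to the unit disk. -/
theorem exists_homeomorph_trapezoid {L : ℕ} (hL : 2 ≤ L) : ∃ h : ℂ ≃ₜ ℂ,
    h '' trapezoid L = Metric.closedBall 0 1 ∧ h '' frontier (trapezoid L) = Metric.sphere 0 1 := by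
  have hL' : (2 : ℝ) ≤ L := by exact_mod_cast hL
  obtain ⟨h, -, h2, h3⟩ := exists_homeomorph_image_interior_closure_frontier_eq_unitBall
    (convex_trapezoid L) ⟨⟨1, 1 / 2⟩, mem_interior_trapezoid (by norm_num) (by norm_num)
      (by norm_num) (by show (1 / 2 : ℝ) < L - 1; linarith)⟩ (isBounded_trapezoid L)
  rw [(isClosed_trapezoid L).closure_eq] at h2
  exact ⟨h, h2, h3⟩

/-! ### Reparametrization of a leg -/

/-- The piecewise affine map of `[0, L]` onto `[α, β]` that fixes `[1, L - 1]`. -/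
noncomputable def legParam (α β : ℝ) (L : ℕ) (r : ℝ) : ℝ :=
  r + α * max 0 (1 - r) - (L - β) * max 0 (r - (L - 1))

section LegParam

variable {α β : ℝ} {L : ℕ}

theorem continuous_legParam : Continuous (legParam α β L) := by
  unfold legParam; fun_prop

theorem legParam_of_le_one (hL : 2 ≤ L) {r : ℝ} (hr : r ≤ 1) :
    legParam α β L r = α + r * (1 - α) := by
  have hL' : (2 : ℝ) ≤ L := by exact_mod_cast hL
  rw [legParam, max_eq_right (by linarith), max_eq_left (by linarith)]; ring

theorem legParam_of_mem {r : ℝ} (h1 : 1 ≤ r) (h2 : r ≤ L - 1) : legParam α β L r = r := by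
  rw [legParam, max_eq_left (by linarith), max_eq_left (by linarith)]; ring

theorem legParam_of_ge (hL : 2 ≤ L) {r : ℝ} (hr : L - 1 ≤ r) :
    legParam α β L r = β - (L - r) * (β - (L - 1)) := by
  have hL' : (2 : ℝ) ≤ L := by exact_mod_cast hL
  rw [legParam, max_eq_left (by linarith), max_eq_right (by linarith)]; ring

/-- The reparametrization stretches only the truncated end pieces and keeps every time in its cell,
so the path and the trapezoid map can be compared cell by cell. -/
theorem legParam_mem_Icc (hL : 2 ≤ L) (hα : α ∈ Ioo (0 : ℝ) 1)
    (hβ : β ∈ Ioo ((L : ℝ) - 1) L) {m : ℕ} (hm : m < L) {r : ℝ} (hr : r ∈ Icc (m : ℝ) (m + 1)) :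
    legParam α β L r ∈ Icc (m : ℝ) (m + 1) := by
  obtain ⟨a0, a1⟩ := hα
  obtain ⟨b0, b1⟩ := hβ
  obtain ⟨r0, r1⟩ := hr
  rcases (show m = 0 ∨ m + 1 = L ∨ (1 ≤ m ∧ m + 2 ≤ L) by omega) with h | h | ⟨h, h'⟩
  · subst h
    norm_num at r0 r1 ⊢
    rw [legParam_of_le_one hL r1]
    constructor <;> nlinarith
  · have h' : (L : ℝ) = m + 1 := by rw [← h]; push_cast; rfl
    rw [legParam_of_ge hL (by linarith)]
    rw [h'] at b0 b1 ⊢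
    constructor <;> nlinarith
  · have h1 : (1 : ℝ) ≤ m := by exact_mod_cast h
    have h2 : (m : ℝ) + 2 ≤ L := by exact_mod_cast h'
    rw [legParam_of_mem (by linarith) (by linarith)]
    exact ⟨r0, r1⟩

theorem image_legParam (hL : 2 ≤ L) (hα : α ∈ Ioo (0 : ℝ) 1) (hβ : β ∈ Ioo ((L : ℝ) - 1) L) :
    legParam α β L '' Icc 0 L = Icc α β := by
  have hL' : (2 : ℝ) ≤ L := by exact_mod_cast hL
  obtain ⟨a0, a1⟩ := hα
  obtain ⟨b0, b1⟩ := hβ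
  apply Subset.antisymm
  · rintro _ ⟨r, ⟨r0, r1⟩, rfl⟩
    rcases le_total r 1 with h | h
    · rw [legParam_of_le_one hL h]; constructor <;> nlinarith
    rcases le_total r (L - 1) with h' | h'
    · rw [legParam_of_mem h h']; constructor <;> linarith
    · rw [legParam_of_ge hL h']; constructor <;> nlinarith
  · have h := intermediate_value_Icc (Nat.cast_nonneg L)
      (continuous_legParam (α := α) (β := β) (L := L)).continuousOn
    rwa [legParam_of_le_one hL zero_le_one, legParam_of_ge hL (by linarith), sub_self, zero_mul,
      zero_mul, add_zero, sub_zero] at h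

end LegParam

/-! ### Legs and strips -/

section Strips

variable {g : ℕ} {X : Fin (2 * g) ≃ Letter g} {Q : ConvexPolygon (4 * g)} {x : ℕ → Letter g}
  {L : ℕ}

/-- A sequence of `L` line segments in the polygon, from `start m` to `final m`, each beginning at
the point glued to the end of the preceding one, which lies on the edge `x m`. -/
structure Leg (X : Fin (2 * g) ≃ Letter g) (Q : ConvexPolygon (4 * g)) (x : ℕ → Letter g)
    (L : ℕ) where
  start : ℕ → ℝ × ℝ
  final : ℕ → ℝ × ℝ
  u : ℕ → ℝ
  start_mem : ∀ m, start m ∈ Q.region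
  final_mem : ∀ m, final m ∈ Q.region
  u_mem : ∀ m, u m ∈ Icc (0 : ℝ) 1
  final_eq : ∀ m, m + 1 < L → final m = edgePt X Q (x m) (u m)
  start_eq : ∀ m, m + 1 < L → start (m + 1) = edgePt X Q (x m).inv (1 - u m)

namespace Leg

variable (A : Leg X Q x L)

/-- The point at time `τ` on the segment that is traversed between the times `m` and `m + 1`. -/
noncomputable def segPt (m : ℕ) (τ : ℝ) : ℝ × ℝ :=
  AffineMap.lineMap (A.start m) (A.final m) (τ - m)

/-- The lift of a leg to the universal cover. -/
noncomputable def path : ℝ → UnivCover X Q :=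
  glued (fun m τ => cell X Q (wordElt x m) (A.segPt m τ)) id L

theorem segPt_mem {m : ℕ} {τ : ℝ} (hτ : τ ∈ Icc (m : ℝ) (m + 1)) : A.segPt m τ ∈ Q.region :=
  Q.convex_region.lineMap_mem (A.start_mem m) (A.final_mem m)
    ⟨by linarith [hτ.1], by linarith [hτ.2]⟩

theorem path_agree (m : ℕ) (hm : m + 1 < L) (τ : ℝ) (_ : τ ∈ Icc (0 : ℝ) L)
    (hτ : id τ = m + 1) : cell X Q (wordElt x m) (A.segPt m τ) =
      cell X Q (wordElt x (m + 1)) (A.segPt (m + 1) τ) := by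
  have h : τ = m + 1 := hτ
  rw [segPt, segPt, h, add_sub_cancel_left, AffineMap.lineMap_apply_one, Nat.cast_add,
    Nat.cast_one, sub_self, AffineMap.lineMap_apply_zero, A.final_eq m hm, A.start_eq m hm,
    wordElt_succ]
  exact cell_edgePt X Q _ _ (A.u_mem m)

theorem path_eq {m : ℕ} (hm : m < L) {τ : ℝ} (hτ : τ ∈ Icc (m : ℝ) (m + 1)) :
    A.path τ = cell X Q (wordElt x m) (A.segPt m τ) := by
  refine glued_eq (s := Icc (0 : ℝ) L) A.path_agree hm ?_ hτ
  have : (m : ℝ) + 1 ≤ L := by exact_mod_cast hm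
  exact ⟨(Nat.cast_nonneg m).trans hτ.1, hτ.2.trans this⟩

theorem continuousOn_path (hL : 0 < L) : ContinuousOn A.path (Icc 0 L) := by
  refine continuousOn_glued hL isClosed_Icc continuous_id (fun _ h => h) (fun m _ => ?_)
    A.path_agree
  refine (continuousOn_cell X Q _).comp ?_ fun τ hτ => A.segPt_mem hτ.2
  unfold segPt
  simp only [AffineMap.lineMap_apply]
  fun_prop

end Leg

/-- Two legs along the same reduced word that cross in the first and in the last cell, at the times
`α, β` of the first leg and `α', β'` of the second one, and do not cross in between. -/
structure Strip (X : Fin (2 * g) ≃ Letter g) (Q : ConvexPolygon (4 * g)) (x : ℕ → Letter g)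
    (L : ℕ) where
  A : Leg X Q x L
  B : Leg X Q x L
  α : ℝ
  β : ℝ
  α' : ℝ
  β' : ℝ
  two_le : 2 ≤ L
  reduced : ∀ m, m + 2 < L → x (m + 1) ≠ (x m).inv
  u_ne : ∀ m, m + 1 < L → A.u m ≠ B.u m
  α_mem : α ∈ Ioo (0 : ℝ) 1
  α'_mem : α' ∈ Ioo (0 : ℝ) 1
  β_mem : β ∈ Ioo ((L : ℝ) - 1) L
  β'_mem : β' ∈ Ioo ((L : ℝ) - 1) L
  first : A.segPt 0 α = B.segPt 0 α'
  last : A.segPt (L - 1) β = B.segPt (L - 1) β'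
  side_first : edgeSide X Q (x 0) (A.start 0) < 0
  side_last : edgeSide X Q (x (L - 2)).inv (A.final (L - 1)) < 0
  noncross : ∀ m, 0 < m → m + 1 < L →
    0 < orient (A.start m) (A.final m) (B.start m) * orient (A.start m) (A.final m) (B.final m)
  noncross' : ∀ m, 0 < m → m + 1 < L →
    0 < orient (B.start m) (B.final m) (A.start m) * orient (B.start m) (B.final m) (A.final m)

namespace Strip

variable (S : Strip X Q x L)

/-- The map of the part `m ≤ re z ≤ m + 1` of the trapezoid into the polygon. -/
noncomputable def pt (m : ℕ) (z : ℂ) : ℝ × ℝ :=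
  if m = 0 then triMap (S.A.segPt 0 S.α) (S.A.final 0) (S.B.final 0) z.re z.im
  else if m + 1 = L then
    -- The last triangle has its apex at `re z = L`, so distance from the apex is `L - re z`.
    triMap (S.A.segPt (L - 1) S.β) (S.A.start m) (S.B.start m) (L - z.re) z.im
  else quadMap (S.A.start m) (S.B.start m) (S.A.final m) (S.B.final m) (z.re - m) z.im

theorem pt_zero (z : ℂ) :
    S.pt 0 z = triMap (S.A.segPt 0 S.α) (S.A.final 0) (S.B.final 0) z.re z.im := if_pos rfl

theorem pt_last {m : ℕ} (hm : m + 1 = L) (z : ℂ) : S.pt m z =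
    triMap (S.A.segPt (L - 1) S.β) (S.A.start m) (S.B.start m) (L - z.re) z.im := by
  have := S.two_le
  rw [pt, if_neg (by omega), if_pos hm]

theorem pt_mid {m : ℕ} (h0 : 0 < m) (hm : m + 1 < L) (z : ℂ) : S.pt m z =
    quadMap (S.A.start m) (S.B.start m) (S.A.final m) (S.B.final m) (z.re - m) z.im := by
  rw [pt, if_neg (by omega), if_neg (by omega)]

theorem continuous_pt (m : ℕ) : Continuous (S.pt m) := by
  unfold pt
  have h1 := Complex.continuous_im
  have h2 := Complex.continuous_re
  split_ifs
  · exact continuous_triMap _ _ _ h2 h1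
  · exact continuous_triMap _ _ _ (continuous_const.sub h2) h1
  · exact continuous_quadMap _ _ _ _ (h2.sub continuous_const) h1

theorem apex_mem : S.A.segPt 0 S.α ∈ Q.region :=
  S.A.segPt_mem (by have := S.α_mem; constructor <;> norm_num <;> linarith [this.1, this.2])

theorem cast_pred (S : Strip X Q x L) : ((L - 1 : ℕ) : ℝ) = L - 1 := by
  have := S.two_le
  rw [Nat.cast_sub (by omega), Nat.cast_one]

theorem apex'_mem : S.A.segPt (L - 1) S.β ∈ Q.region := by
  refine S.A.segPt_mem ?_
  rw [S.cast_pred]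
  exact ⟨S.β_mem.1.le, by linarith [S.β_mem.2]⟩

theorem pt_mem {m : ℕ} (hm : m < L) {z : ℂ} (hz : z ∈ trapezoid L)
    (hr : z.re ∈ Icc (m : ℝ) (m + 1)) : S.pt m z ∈ Q.region := by
  obtain ⟨z1, z2, z3, z4⟩ := hz
  rcases (show m = 0 ∨ m + 1 = L ∨ (0 < m ∧ m + 1 < L) by omega) with h | h | ⟨h, h'⟩
  · subst h
    rw [S.pt_zero]
    exact triMap_mem Q.convex_region S.apex_mem (S.A.final_mem 0) (S.B.final_mem 0) z1 z3
      (by simpa using hr.2)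
  · rw [S.pt_last h]
    have h' : (L : ℝ) = m + 1 := by rw [← h]; push_cast; rfl
    exact triMap_mem Q.convex_region S.apex'_mem (S.A.start_mem m) (S.B.start_mem m) z1 z4
      (by linarith [hr.1])
  · rw [S.pt_mid h h']
    exact quadMap_mem Q.convex_region (S.A.start_mem m) (S.B.start_mem m) (S.A.final_mem m)
      (S.B.final_mem m) ⟨by linarith [hr.1], by linarith [hr.2]⟩ ⟨z1, z2⟩

theorem pt_right {m : ℕ} (hm : m + 1 < L) {z : ℂ} (hr : z.re = m + 1) :
    S.pt m z = AffineMap.lineMap (S.A.final m) (S.B.final m) z.im := by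
  rcases Nat.eq_zero_or_pos m with h | h
  · subst h
    have h1 : z.re = 1 := by simpa using hr
    rw [S.pt_zero, h1, triMap_one_left]
  · rw [S.pt_mid h hm, hr, add_sub_cancel_left, quadMap, AffineMap.lineMap_apply_one,
      AffineMap.lineMap_apply_one]

theorem pt_left {m : ℕ} (h0 : 0 < m) (hm : m < L) {z : ℂ} (hr : z.re = m) :
    S.pt m z = AffineMap.lineMap (S.A.start m) (S.B.start m) z.im := by
  rcases (show m + 1 < L ∨ m + 1 = L by omega) with h | h
  · rw [S.pt_mid h0 h, hr, sub_self, quadMap, AffineMap.lineMap_apply_zero,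
      AffineMap.lineMap_apply_zero]
  · have h' : (L : ℝ) = m + 1 := by rw [← h]; push_cast; rfl
    rw [S.pt_last h, hr, h', add_sub_cancel_left, triMap_one_left]

/-- Both pieces interpolate affinely between the two legs along the common edge, and the gluing `u ↦
1 - u` is affine. -/
theorem pt_agree (m : ℕ) (hm : m + 1 < L) (z : ℂ) (hz : z ∈ trapezoid L)
    (hr : z.re = m + 1) : cell X Q (wordElt x m) (S.pt m z) =
      cell X Q (wordElt x (m + 1)) (S.pt (m + 1) z) := by
  rw [S.pt_right hm hr, S.pt_left (Nat.succ_pos m) hm (by push_cast; exact hr),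
    S.A.final_eq m hm, S.B.final_eq m hm, S.A.start_eq m hm, S.B.start_eq m hm, lineMap_edgePt,
    lineMap_edgePt, wordElt_succ]
  have e : (AffineMap.lineMap (1 - S.A.u m) (1 - S.B.u m) z.im : ℝ) =
      1 - AffineMap.lineMap (S.A.u m) (S.B.u m) z.im := by
    rw [AffineMap.lineMap_apply_ring', AffineMap.lineMap_apply_ring']; ring
  rw [e]
  exact cell_edgePt X Q _ _
    ((convex_Icc (0 : ℝ) 1).lineMap_mem (S.A.u_mem m) (S.B.u_mem m) ⟨hz.1, hz.2.1⟩)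

/-- The apex precedes the final point of a segment that starts off the exit edge. Hence the first
triangle is nondegenerate and meets that edge only in its base. -/
theorem side_apex : edgeSide X Q (x 0) (S.A.segPt 0 S.α) < 0 := by
  have h := S.two_le
  have hα := S.α_mem
  rw [Leg.segPt, edgeSide_lineMap, S.A.final_eq 0 (by omega), edgeSide_self, mul_zero, add_zero,
    Nat.cast_zero, sub_zero]
  exact mul_neg_of_pos_of_neg (by linarith [hα.2]) S.side_first

theorem side_apex' : edgeSide X Q (x (L - 2)).inv (S.A.segPt (L - 1) S.β) < 0 := by
  have h := S.two_le
  have hβ := S.β_mem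
  have e : L - 1 = L - 2 + 1 := by omega
  have hs := S.A.start_eq (L - 2) (by omega)
  rw [← e] at hs
  rw [Leg.segPt, edgeSide_lineMap, hs, edgeSide_self, mul_zero, zero_add, S.cast_pred]
  exact mul_neg_of_pos_of_neg (by linarith [hβ.1]) S.side_last

/-- A piece of the strip meets the edge through which it is left only at its end. -/
theorem re_eq_of_edgeSide_eq_zero {m : ℕ} (hm : m + 1 < L) {z : ℂ} (hz : z ∈ trapezoid L)
    (h : edgeSide X Q (x m) (S.pt m z) = 0) : z.re = m + 1 := by
  obtain ⟨z1, z2, z3, z4⟩ := hz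
  rcases Nat.eq_zero_or_pos m with h0 | h0
  · subst h0
    rw [S.pt_zero, edgeSide_triMap, S.A.final_eq 0 hm, S.B.final_eq 0 hm, edgeSide_self,
      edgeSide_self, mul_zero, mul_zero, add_zero, add_zero] at h
    have := (mul_eq_zero.1 h).resolve_right S.side_apex.ne
    push_cast
    linarith
  · obtain ⟨p, rfl⟩ : ∃ p, m = p + 1 := ⟨m - 1, by omega⟩
    rw [S.pt_mid h0 hm, edgeSide_quadMap, S.A.final_eq _ hm, S.B.final_eq _ hm, edgeSide_self,
      edgeSide_self, mul_zero, mul_zero, add_zero, mul_zero, add_zero,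
      S.A.start_eq p (by omega), S.B.start_eq p (by omega)] at h
    have hA := S.A.u_mem p
    have hB := S.B.u_mem p
    have hne := S.reduced p (by omega)
    have n1 := edgeSide_neg (X := X) Q hne (u := 1 - S.A.u p)
      ⟨by linarith [hA.2], by linarith [hA.1]⟩
    have n2 := edgeSide_neg (X := X) Q hne (u := 1 - S.B.u p)
      ⟨by linarith [hB.2], by linarith [hB.1]⟩
    have := (mul_eq_zero.1 h).resolve_right (convexComb_neg n1 n2 ⟨z1, z2⟩).ne
    linarith

theorem pt_inj {m : ℕ} (hm : m < L) {z w : ℂ}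
    (hzr : z.re ∈ Icc (m : ℝ) (m + 1)) (hw : w ∈ trapezoid L)
    (e : S.pt m z = S.pt m w) : z = w := by
  rcases (show m = 0 ∨ m + 1 = L ∨ (0 < m ∧ m + 1 < L) by omega) with h | h | ⟨h, h'⟩
  · subst h
    have h2 := S.two_le
    rw [S.pt_zero, S.pt_zero] at e
    have hne : orient (S.A.segPt 0 S.α) (S.A.final 0) (S.B.final 0) ≠ 0 := by
      rw [← orient_rotate, S.A.final_eq 0 (by omega), S.B.final_eq 0 (by omega),
        orient_edgePt_edgePt]
      exact mul_ne_zero (sub_ne_zero.2 (S.u_ne 0 (by omega)).symm) S.side_apex.ne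
    obtain ⟨h3, h4⟩ := triMap_inj hne e
    exact Complex.ext h3 h4
  · have h2 := S.two_le
    rw [S.pt_last h, S.pt_last h] at e
    have em : m = L - 2 + 1 := by omega
    have hne : orient (S.A.segPt (L - 1) S.β) (S.A.start m) (S.B.start m) ≠ 0 := by
      rw [← orient_rotate, em, S.A.start_eq (L - 2) (by omega), S.B.start_eq (L - 2) (by omega),
        orient_edgePt_edgePt]
      refine mul_ne_zero (fun h0 => S.u_ne (L - 2) (by omega) ?_) S.side_apex'.ne
      linarith
    obtain ⟨h3, h4⟩ := triMap_inj hne e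
    exact Complex.ext (by linarith) h4
  · rw [S.pt_mid h h', S.pt_mid h h'] at e
    obtain ⟨p, rfl⟩ : ∃ p, m = p + 1 := ⟨m - 1, by omega⟩
    have hA := S.A.u_mem (p + 1)
    have hB := S.B.u_mem (p + 1)
    have hne := S.reduced p (by omega)
    have n1 := edgeSide_neg (X := X) Q hne.symm hA
    have n2 := edgeSide_neg (X := X) Q hne.symm hB
    -- Both legs enter through one edge. Each orientation is a difference of entry positions times a
    -- negative edge side, and the two differences are opposite.
    have hside : orient (S.A.start (p + 1)) (S.A.final (p + 1)) (S.B.start (p + 1)) *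
        orient (S.B.start (p + 1)) (S.B.final (p + 1)) (S.A.start (p + 1)) < 0 := by
      have hd : S.A.u p - S.B.u p ≠ 0 := sub_ne_zero.2 (S.u_ne p (by omega))
      have n3 := mul_pos (mul_pos_of_neg_of_neg n1 n2) (mul_self_pos.2 hd)
      rw [orient_rotate (S.B.start (p + 1)), orient_rotate (S.A.start (p + 1)),
        S.A.start_eq p (by omega), S.B.start_eq p (by omega),
        S.A.final_eq _ h', S.B.final_eq _ h', orient_edgePt_edgePt, orient_edgePt_edgePt]
      linarith
    obtain ⟨h3, h4⟩ := quadMap_inj (S.noncross _ h h') (S.noncross' _ h h') hside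
      ⟨by linarith [hzr.1], by linarith [hzr.2]⟩ ⟨hw.1, hw.2.1⟩ e
    exact Complex.ext (by linarith) h4

/-- The map of the trapezoid into the universal cover. -/
noncomputable def map : ℂ → UnivCover X Q :=
  glued (fun m z => cell X Q (wordElt x m) (S.pt m z)) Complex.re L

theorem map_eq {m : ℕ} (hm : m < L) {z : ℂ} (hz : z ∈ trapezoid L)
    (hr : z.re ∈ Icc (m : ℝ) (m + 1)) : S.map z = cell X Q (wordElt x m) (S.pt m z) :=
  glued_eq S.pt_agree hm hz hr

theorem re_mem {z : ℂ} (hz : z ∈ trapezoid L) : z.re ∈ Icc (0 : ℝ) L :=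
  ⟨hz.1.trans hz.2.2.1, by linarith [hz.1, hz.2.2.2]⟩

theorem continuousOn_map : ContinuousOn S.map (trapezoid L) := by
  have hL := S.two_le
  refine continuousOn_glued (by omega) (isClosed_trapezoid L) Complex.continuous_re
    (fun z hz => re_mem hz) (fun m hm => ?_) S.pt_agree
  exact (continuousOn_cell X Q _).comp (S.continuous_pt m).continuousOn
    fun z hz => S.pt_mem hm hz.1 hz.2

/-- Points in different cells can coincide only if the cells are consecutive and the first point is
on the exit edge. Then its real part is the integer between the two slices, so it may be read in the
later cell, where the map is injective. -/
theorem injOn_map : InjOn S.map (trapezoid L) := by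
  have hL := S.two_le
  have key : ∀ m m' : ℕ, m ≤ m' → m' < L → ∀ z ∈ trapezoid L, ∀ w ∈ trapezoid L,
      z.re ∈ Icc (m : ℝ) (m + 1) → w.re ∈ Icc (m' : ℝ) (m' + 1) → S.map z = S.map w → z = w := by
    intro m m' hmm hm' z hz w hw hzr hwr e
    have e' := e
    rw [S.map_eq (by omega) hz hzr, S.map_eq hm' hw hwr] at e'
    rcases hmm.eq_or_lt with rfl | hlt
    · refine S.pt_inj hm' hzr hw ?_
      exact cell_injOn X Q _ (S.pt_mem hm' hz hzr) (S.pt_mem hm' hw hwr) e'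
    · rcases cell_eq_cell X Q (S.pt_mem (by omega) hz hzr) (S.pt_mem hm' hw hwr) e' with h | h
      · exact absurd h.1 (wordElt_injOn S.reduced hlt hm')
      · obtain ⟨y, u, -, h1, h2, -⟩ := h
        obtain ⟨rfl, rfl⟩ := wordElt_adjacent S.reduced hlt hm' h1
        have hre : z.re = m + 1 := S.re_eq_of_edgeSide_eq_zero hm' hz
          (by rw [h2, edgeSide_self])
        have hzr' : z.re ∈ Icc ((m + 1 : ℕ) : ℝ) ((m + 1 : ℕ) + 1) := by
          rw [hre]; push_cast; constructor <;> linarith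
        rw [S.map_eq hm' hz hzr', S.map_eq hm' hw hwr] at e
        refine S.pt_inj hm' hzr' hw ?_
        exact cell_injOn X Q _ (S.pt_mem hm' hz hzr') (S.pt_mem hm' hw hwr) e
  intro z hz w hw e
  obtain ⟨m, hm, hzr⟩ := exists_mem_Icc_nat (by omega) (re_mem hz)
  obtain ⟨m', hm', hwr⟩ := exists_mem_Icc_nat (by omega) (re_mem hw)
  rcases le_total m m' with h | h
  · exact key m m' h hm' z hz w hw hzr hwr e
  · exact (key m' m h hm w hw z hz hwr hzr e.symm).symm

theorem map_bottom {r : ℝ} (hr : r ∈ Icc (0 : ℝ) L) :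
    S.map ⟨r, 0⟩ = S.A.path (legParam S.α S.β L r) := by
  have hL := S.two_le
  obtain ⟨m, hm, hrm⟩ := exists_mem_Icc_nat (by omega) hr
  have hz : (⟨r, 0⟩ : ℂ) ∈ trapezoid L := ⟨le_rfl, zero_le_one, hr.1, sub_nonneg.2 hr.2⟩
  rw [S.map_eq hm hz hrm, S.A.path_eq hm (legParam_mem_Icc hL S.α_mem S.β_mem hm hrm)]
  congr 1
  rcases (show m = 0 ∨ m + 1 = L ∨ (0 < m ∧ m + 1 < L) by omega) with h | h | ⟨h, h'⟩
  · subst h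
    rw [S.pt_zero, triMap_zero_right, legParam_of_le_one hL (by simpa using hrm.2)]
    simp only [Leg.segPt, AffineMap.lineMap_apply, vsub_eq_sub, vadd_eq_add, Nat.cast_zero]
    module
  · obtain rfl : m = L - 1 := by omega
    rw [S.pt_last h, triMap_zero_right, legParam_of_ge hL (by simpa [S.cast_pred] using hrm.1)]
    simp only [Leg.segPt, AffineMap.lineMap_apply, vsub_eq_sub, vadd_eq_add, S.cast_pred]
    module
  · rw [S.pt_mid h h', quadMap, AffineMap.lineMap_apply_zero, legParam_of_mem, Leg.segPt]
    · exact le_trans (by exact_mod_cast h) hrm.1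
    · have : (m : ℝ) + 2 ≤ L := by exact_mod_cast h'
      linarith [hrm.2]

theorem map_top {r : ℝ} (hr : r ∈ Icc (0 : ℝ) L) :
    S.map ⟨r, min 1 (min r (L - r))⟩ = S.B.path (legParam S.α' S.β' L r) := by
  have hL := S.two_le
  have hL' : (2 : ℝ) ≤ L := by exact_mod_cast hL
  obtain ⟨m, hm, hrm⟩ := exists_mem_Icc_nat (by omega) hr
  have hz : (⟨r, min 1 (min r (L - r))⟩ : ℂ) ∈ trapezoid L :=
    ⟨le_min zero_le_one (le_min hr.1 (sub_nonneg.2 hr.2)), min_le_left _ _,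
      (min_le_right _ _).trans (min_le_left _ _), (min_le_right _ _).trans (min_le_right _ _)⟩
  rw [S.map_eq hm hz hrm, S.B.path_eq hm (legParam_mem_Icc hL S.α'_mem S.β'_mem hm hrm)]
  congr 1
  rcases (show m = 0 ∨ m + 1 = L ∨ (0 < m ∧ m + 1 < L) by omega) with h | h | ⟨h, h'⟩
  · subst h
    have h1 : r ≤ 1 := by simpa using hrm.2
    have e : min 1 (min r (L - r)) = r := by
      rw [min_eq_left (by linarith : r ≤ L - r), min_eq_right h1]
    simp only [e]
    -- The apex is defined on leg `A`; `S.first` rewrites it as a point of leg `B`.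
    rw [S.pt_zero, triMap_diag, legParam_of_le_one hL h1, S.first]
    simp only [Leg.segPt, AffineMap.lineMap_apply, vsub_eq_sub, vadd_eq_add, Nat.cast_zero]
    module
  · obtain rfl : m = L - 1 := by omega
    have h1 : (L : ℝ) - 1 ≤ r := by simpa [S.cast_pred] using hrm.1
    have e : min 1 (min r (L - r)) = L - r := by
      rw [min_eq_right (by linarith : L - r ≤ r), min_eq_right (by linarith)]
    simp only [e]
    rw [S.pt_last h, triMap_diag, legParam_of_ge hL h1, S.last]
    simp only [Leg.segPt, AffineMap.lineMap_apply, vsub_eq_sub, vadd_eq_add, S.cast_pred]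
    module
  · have h1 : (1 : ℝ) ≤ r := le_trans (by exact_mod_cast h) hrm.1
    have h2 : r ≤ L - 1 := by
      have : (m : ℝ) + 2 ≤ L := by exact_mod_cast h'
      linarith [hrm.2]
    have e : min 1 (min r (L - r)) = 1 := min_eq_left (le_min h1 (by linarith))
    simp only [e]
    rw [S.pt_mid h h', quadMap, AffineMap.lineMap_apply_one, legParam_of_mem h1 h2, Leg.segPt]

theorem map_image_frontier : S.map '' frontier (trapezoid L) =
    S.A.path '' Icc S.α S.β ∪ S.B.path '' Icc S.α' S.β' := by
  have hL := S.two_le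
  rw [frontier_trapezoid, ← image_legParam hL S.α_mem S.β_mem,
    ← image_legParam hL S.α'_mem S.β'_mem]
  apply Subset.antisymm
  · rintro _ ⟨z, ⟨hz, h | h⟩, rfl⟩
    · left
      refine ⟨_, ⟨z.re, re_mem hz, rfl⟩, ?_⟩
      rw [← S.map_bottom (re_mem hz), ← h]
    · right
      refine ⟨_, ⟨z.re, re_mem hz, rfl⟩, ?_⟩
      rw [← S.map_top (re_mem hz), ← h]
  · rintro _ (⟨_, ⟨r, hr, rfl⟩, rfl⟩ | ⟨_, ⟨r, hr, rfl⟩, rfl⟩)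
    · refine ⟨⟨r, 0⟩, ⟨⟨le_rfl, zero_le_one, hr.1, sub_nonneg.2 hr.2⟩, Or.inl rfl⟩, ?_⟩
      exact S.map_bottom hr
    · refine ⟨⟨r, min 1 (min r (L - r))⟩, ⟨⟨le_min zero_le_one (le_min hr.1 (sub_nonneg.2 hr.2)),
        min_le_left _ _, (min_le_right _ _).trans (min_le_left _ _),
        (min_le_right _ _).trans (min_le_right _ _)⟩, Or.inr rfl⟩, ?_⟩
      exact S.map_top hr

/-- The two legs of a strip bound an embedded closed disk. -/
theorem exists_disk : ∃ φ : Metric.closedBall (0 : ℂ) 1 → UnivCover X Q,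
    Continuous φ ∧ Function.Injective φ ∧
    φ '' {z | ‖(z : ℂ)‖ = 1} = S.A.path '' Icc S.α S.β ∪ S.B.path '' Icc S.α' S.β' := by
  obtain ⟨h, h1, h2⟩ := exists_homeomorph_trapezoid S.two_le
  have hmem : ∀ z : Metric.closedBall (0 : ℂ) 1, h.symm z ∈ trapezoid L := by
    intro z
    obtain ⟨w, hw, e⟩ : (z : ℂ) ∈ h '' trapezoid L := by rw [h1]; exact z.2
    rw [← e, h.symm_apply_apply]
    exact hw
  refine ⟨fun z => S.map (h.symm z), ?_, ?_, ?_⟩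
  · exact S.continuousOn_map.comp_continuous (h.symm.continuous.comp continuous_subtype_val) hmem
  · intro z w e
    exact Subtype.ext (h.symm.injective (S.injOn_map (hmem z) (hmem w) e))
  · rw [← S.map_image_frontier]
    ext y
    constructor
    · rintro ⟨z, hz, rfl⟩
      have hz' : (z : ℂ) ∈ Metric.sphere (0 : ℂ) 1 := mem_sphere_zero_iff_norm.2 hz
      rw [← h2] at hz'
      obtain ⟨w, hw, e⟩ := hz'
      refine ⟨w, hw, ?_⟩
      simp only [← e, h.symm_apply_apply]
    · rintro ⟨w, hw, rfl⟩
      have hz' : h w ∈ Metric.sphere (0 : ℂ) 1 := h2 ▸ mem_image_of_mem h hw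
      refine ⟨⟨h w, Metric.sphere_subset_closedBall hz'⟩, mem_sphere_zero_iff_norm.1 hz', ?_⟩
      simp only [h.symm_apply_apply]

end Strip

end Strips

/-! ### Combinatorics of curve codes -/

theorem LPoint.inv_inv {g : ℕ} (p : LPoint g) : p.inv.inv = p := by
  simp [LPoint.inv, Letter.inv]

/-- The endpoint through which a segment is entered when it is traced forwards or in reverse. -/
def entryPt {g : ℕ} (rev : Bool) (s : LPoint g × LPoint g) : LPoint g := if rev then s.2 else s.1

theorem legIdx_zero (rev : Bool) (l : ℤ) : legIdx rev l 0 = l := by simp [legIdx]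

namespace CurveCode

variable {g n : ℕ} (D : CurveCode g n)

theorem seg_fst_mem (k : ℤ) : (D.seg k).1 ∈ D.P := (D.mem_iff _).2 ⟨_, Or.inl rfl⟩

theorem seg_snd_mem (k : ℤ) : (D.seg k).2 ∈ D.P := (D.mem_iff _).2 ⟨_, Or.inr rfl⟩

theorem entryPt_mem (rev : Bool) (k : ℤ) : entryPt rev (D.seg k) ∈ D.P := by
  cases rev
  exacts [D.seg_fst_mem k, D.seg_snd_mem k]

theorem exitPt_mem (rev : Bool) (k : ℤ) : exitPt rev (D.seg k) ∈ D.P := by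
  cases rev
  exacts [D.seg_snd_mem k, D.seg_fst_mem k]

theorem seg_succ_fst (k : ℤ) : (D.seg (k + 1)).1 = (D.seg k).2.inv := by
  simp only [seg, Int.cast_add, Int.cast_one]
  exact D.next _

theorem entryPt_succ (rev : Bool) (l m : ℤ) :
    entryPt rev (D.seg (legIdx rev l (m + 1))) = (exitPt rev (D.seg (legIdx rev l m))).inv := by
  cases rev
  · have h := D.seg_succ_fst (l + m)
    rw [add_assoc] at h
    simpa [entryPt, exitPt, legIdx] using h
  · have h := D.seg_succ_fst (l - (m + 1))
    rw [show l - (m + 1) + 1 = l - m by ring] at h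
    simp only [entryPt, exitPt, legIdx, if_true, h, LPoint.inv_inv]

/-- A segment enters through the edge inverse to the preceding letter; leaving through the same edge
would be a cancellation in `W`. -/
theorem edge_ne (k : ℤ) : (D.seg k).1.1 ≠ (D.seg k).2.1 := by
  intro h
  have h1 := D.seg_succ_fst (k - 1)
  rw [sub_add_cancel] at h1
  rw [h1] at h
  have h2 := D.reduced ((k - 1 : ℤ) : ZMod n)
  rw [← D.word, ← D.word] at h2
  apply h2
  have e : (((k - 1 : ℤ) : ZMod n) + 1) = (k : ZMod n) := by push_cast; ring
  rw [e]
  exact h.symm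

theorem seg_eq_iff {k k' : ℤ} : D.seg k = D.seg k' ↔ (k : ZMod n) = k' :=
  ⟨fun h => D.fst_inj _ _ (congrArg Prod.fst h), fun h => by rw [seg, h, seg]⟩

theorem seg_fst_ne {k k' : ℤ} (h : D.seg k ≠ D.seg k') : (D.seg k).1 ≠ (D.seg k').1 :=
  fun e => h (D.seg_eq_iff.2 (D.fst_inj _ _ e))

theorem seg_snd_ne {k k' : ℤ} (h : D.seg k ≠ D.seg k') : (D.seg k).2 ≠ (D.seg k').2 :=
  fun e => h (D.seg_eq_iff.2 (D.snd_inj _ _ e))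

theorem seg_fst_ne_snd (k k' : ℤ) : (D.seg k).1 ≠ (D.seg k').2 := D.fst_ne_snd _ _

theorem idx_ne {p q : LPoint g} (hp : p ∈ D.P) (h : p ≠ q) : D.P.idxOf p ≠ D.P.idxOf q :=
  fun e => h ((List.idxOf_inj hp).1 e)

theorem Crosses.seg_ne {D : CurveCode g n} {i j : ℤ} (h : D.Crosses i j) :
    D.seg i ≠ D.seg j := by
  intro e
  rw [Crosses, ← e] at h
  simp only [Between, Xor] at h
  omega

/-- The four endpoints have distinct indices in `P`, and separation of two pairs in a linear order
is a symmetric condition. -/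
theorem Crosses.symm {D : CurveCode g n} {i j : ℤ} (h : D.Crosses i j) : D.Crosses j i := by
  have hne := h.seg_ne
  have h1 := D.idx_ne (D.seg_fst_mem i) (D.seg_fst_ne hne)
  have h2 := D.idx_ne (D.seg_snd_mem i) (D.seg_snd_ne hne)
  have h3 := D.idx_ne (D.seg_fst_mem i) (D.seg_fst_ne_snd i j)
  have h4 := D.idx_ne (D.seg_fst_mem j) (D.seg_fst_ne_snd j i)
  have h5 := D.idx_ne (D.seg_fst_mem i) (D.seg_fst_ne_snd i i)
  have h6 := D.idx_ne (D.seg_fst_mem j) (D.seg_fst_ne_snd j j)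
  simp only [Crosses, Between, Xor] at h ⊢
  omega

theorem edge_le_of_idx_lt {p q : LPoint g} (hp : p ∈ D.P) (hq : q ∈ D.P)
    (h : D.P.idxOf p < D.P.idxOf q) : D.X.symm p.1 ≤ D.X.symm q.1 := by
  by_contra hlt
  exact absurd (D.edges q hq p hp (not_le.1 hlt)) h.not_gt

/-- Each edge occupies a contiguous block of `P`. -/
theorem Between.edge_eq {D : CurveCode g n} {p q r : LPoint g} (hp : p ∈ D.P) (hq : q ∈ D.P)
    (hr : r ∈ D.P) (e : p.1 = q.1) (h : D.Between p q r) : r.1 = p.1 := by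
  have key : ∀ {p q : LPoint g}, p ∈ D.P → q ∈ D.P → p.1 = q.1 → D.P.idxOf p < D.P.idxOf r →
      D.P.idxOf r < D.P.idxOf q → r.1 = p.1 := by
    intro p q hp hq e h1 h2
    have h3 := D.edge_le_of_idx_lt hp hr h1
    have h4 := D.edge_le_of_idx_lt hr hq h2
    rw [← e] at h4
    exact D.X.symm.injective (le_antisymm h4 h3)
  obtain ⟨h1, h2⟩ := h
  rcases le_total (D.P.idxOf p) (D.P.idxOf q) with h | h
  · rw [min_eq_left h] at h1; rw [max_eq_right h] at h2
    exact key hp hq e h1 h2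
  · rw [min_eq_right h] at h1; rw [max_eq_left h] at h2
    exact (key hq hp e.symm h1 h2).trans e.symm

theorem between_comm {p q r : LPoint g} : D.Between p q r ↔ D.Between q p r := by
  rw [Between, Between, min_comm, max_comm]

end CurveCode

/-! ### Geometry of segmented representatives -/

namespace SegRep

variable {g n : ℕ} {D : CurveCode g n} (R : SegRep D)

theorem pos_mem_Icc {p : LPoint g} (hp : p ∈ D.P) : R.pos p ∈ Icc (0 : ℝ) 1 :=
  Ioo_subset_Icc_self (R.pos_mem p hp)

theorem pos_ne {p q : LPoint g} (hp : p ∈ D.P) (hq : q ∈ D.P) (e : p.1 = q.1) (h : p ≠ q) :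
    R.pos p ≠ R.pos q := by
  rcases (D.idx_ne hp h).lt_or_gt with h' | h'
  · exact (R.pos_lt p hp q hq e h').ne
  · exact (R.pos_lt q hq p hp e.symm h').ne'

theorem pos_between {p q r : LPoint g} (hp : p ∈ D.P) (hq : q ∈ D.P) (hr : r ∈ D.P)
    (e : p.1 = q.1) (h : D.Between p q r) :
    R.pos q < R.pos r ∧ R.pos r < R.pos p ∨ R.pos p < R.pos r ∧ R.pos r < R.pos q := by
  have er := h.edge_eq hp hq hr e
  obtain ⟨h1, h2⟩ := h
  rcases le_total (D.P.idxOf p) (D.P.idxOf q) with h | h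
  · rw [min_eq_left h] at h1; rw [max_eq_right h] at h2
    exact Or.inr ⟨R.pos_lt _ hp _ hr er.symm h1, R.pos_lt _ hr _ hq (er.trans e) h2⟩
  · rw [min_eq_right h] at h1; rw [max_eq_left h] at h2
    exact Or.inl ⟨R.pos_lt _ hq _ hr (er.trans e).symm h1, R.pos_lt _ hr _ hp er h2⟩

theorem place_inv {p : LPoint g} (hp : p ∈ D.P) :
    R.place p.inv = edgePt D.X R.Q p.1.inv (1 - R.pos p) := by
  rw [place, R.pos_inv p hp]; rfl

/-- Points in the order of `P` are in clockwise order around the polygon. -/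
theorem orient_place_neg {p q r : LPoint g} (hp : p ∈ D.P) (hq : q ∈ D.P) (hr : r ∈ D.P)
    (hpq : D.P.idxOf p < D.P.idxOf q) (hqr : D.P.idxOf q < D.P.idxOf r)
    (hne : p.1 ≠ q.1 ∨ q.1 ≠ r.1) : orient (R.place p) (R.place q) (R.place r) < 0 := by
  have up := R.pos_mem_Icc hp
  have uq := R.pos_mem_Icc hq
  have ur := R.pos_mem_Icc hr
  rcases (D.edge_le_of_idx_lt hp hq hpq).lt_or_eq with h1 | h1
  · rcases (D.edge_le_of_idx_lt hq hr hqr).lt_or_eq with h2 | h2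
    · exact orient_edgePt_neg R.Q h1 h2 up uq ur
    · have e := D.X.symm.injective h2
      have hlt := R.pos_lt q hq r hr e hqr
      have hn : q.1 ≠ p.1 := fun e' => by simp [e'] at h1
      rw [← orient_rotate, place, place, ← e, orient_edgePt_edgePt]
      exact mul_neg_of_pos_of_neg (sub_pos.2 hlt) (edgeSide_neg R.Q hn up)
  · have e := D.X.symm.injective h1
    have hlt := R.pos_lt p hp q hq e hpq
    have hn : p.1 ≠ r.1 := by
      rcases hne with h | h
      · exact absurd e h
      · rwa [e]
    rw [place, place, ← e, orient_edgePt_edgePt]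
    exact mul_neg_of_pos_of_neg (sub_pos.2 hlt) (edgeSide_neg R.Q hn ur)

theorem orient_place_of_lt {p q r : LPoint g} (hp : p ∈ D.P) (hq : q ∈ D.P) (hr : r ∈ D.P)
    (e : p.1 ≠ q.1) (hrp : r ≠ p) (hrq : r ≠ q) (hlt : D.P.idxOf p < D.P.idxOf q) :
    (D.Between p q r → 0 < orient (R.place p) (R.place q) (R.place r)) ∧
      (¬ D.Between p q r → orient (R.place p) (R.place q) (R.place r) < 0) := by
  have i1 := D.idx_ne hr hrp
  have i2 := D.idx_ne hr hrq
  simp only [CurveCode.Between, min_eq_left hlt.le, max_eq_right hlt.le]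
  constructor
  · rintro ⟨h1, h2⟩
    have h := R.orient_place_neg hp hr hq h1 h2 (by
      by_contra hcon; push Not at hcon; exact e (hcon.1.trans hcon.2))
    rw [← orient_rotate, ← orient_rotate, orient_swap]
    linarith
  · intro h
    rcases i1.lt_or_gt with h1 | h1
    · rw [← orient_rotate, ← orient_rotate]
      exact R.orient_place_neg hr hp hq h1 hlt (Or.inr e)
    · exact R.orient_place_neg hp hq hr hlt (by omega) (Or.inl e)

/-- The endpoints of a chord separate two points of `P` if and only if these lie on different sides
of the chord. -/
theorem orient_place_mul {p q r s : LPoint g} (hp : p ∈ D.P) (hq : q ∈ D.P) (hr : r ∈ D.P)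
    (hs : s ∈ D.P) (e : p.1 ≠ q.1) (hrp : r ≠ p) (hrq : r ≠ q) (hsp : s ≠ p) (hsq : s ≠ q) :
    (Xor (D.Between p q r) (D.Between p q s) →
      orient (R.place p) (R.place q) (R.place r) * orient (R.place p) (R.place q) (R.place s) < 0) ∧
    (¬ Xor (D.Between p q r) (D.Between p q s) →
      0 < orient (R.place p) (R.place q) (R.place r) *
        orient (R.place p) (R.place q) (R.place s)) := by
  have key : ∀ {p q : LPoint g}, p ∈ D.P → q ∈ D.P → p.1 ≠ q.1 → r ≠ p → r ≠ q → s ≠ p → s ≠ q →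
      D.P.idxOf p < D.P.idxOf q →
      (Xor (D.Between p q r) (D.Between p q s) → orient (R.place p) (R.place q) (R.place r) *
        orient (R.place p) (R.place q) (R.place s) < 0) ∧
      (¬ Xor (D.Between p q r) (D.Between p q s) →
        0 < orient (R.place p) (R.place q) (R.place r) *
          orient (R.place p) (R.place q) (R.place s)) := by
    intro p q hp hq e hrp hrq hsp hsq hlt
    obtain ⟨r1, r2⟩ := R.orient_place_of_lt hp hq hr e hrp hrq hlt
    obtain ⟨s1, s2⟩ := R.orient_place_of_lt hp hq hs e hsp hsq hlt
    by_cases hbr : D.Between p q r <;> by_cases hbs : D.Between p q s <;> simp only [Xor, hbr, hbs]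
    · exact ⟨by simp, fun _ => mul_pos (r1 hbr) (s1 hbs)⟩
    · exact ⟨fun _ => mul_neg_of_pos_of_neg (r1 hbr) (s2 hbs), by simp⟩
    · exact ⟨fun _ => mul_neg_of_neg_of_pos (r2 hbr) (s1 hbs), by simp⟩
    · exact ⟨by simp, fun _ => mul_pos_of_neg_of_neg (r2 hbr) (s2 hbs)⟩
  have hpq : p ≠ q := fun h => e (congrArg Prod.fst h)
  rcases (D.idx_ne hp hpq).lt_or_gt with h | h
  · exact key hp hq e hrp hrq hsp hsq h
  · have := key hq hp e.symm hrq hrp hsq hsp h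
    rw [D.between_comm, D.between_comm (r := s), orient_swap, orient_swap _ _ (R.place s),
      neg_mul_neg]
    exact this

theorem orient_mul_neg {i j : ℤ} (h : D.Crosses i j) :
    orient (R.place (D.seg i).1) (R.place (D.seg i).2) (R.place (D.seg j).1) *
      orient (R.place (D.seg i).1) (R.place (D.seg i).2) (R.place (D.seg j).2) < 0 :=
  (R.orient_place_mul (D.seg_fst_mem i) (D.seg_snd_mem i) (D.seg_fst_mem j) (D.seg_snd_mem j)
    (D.edge_ne i) (D.seg_fst_ne h.seg_ne.symm) (D.seg_fst_ne_snd j i)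
    (D.seg_fst_ne_snd i j).symm (D.seg_snd_ne h.seg_ne.symm)).1 h

theorem orient_mul_pos {i j : ℤ} (hne : D.seg i ≠ D.seg j) (h : ¬ D.Crosses i j) :
    0 < orient (R.place (D.seg i).1) (R.place (D.seg i).2) (R.place (D.seg j).1) *
      orient (R.place (D.seg i).1) (R.place (D.seg i).2) (R.place (D.seg j).2) :=
  (R.orient_place_mul (D.seg_fst_mem i) (D.seg_snd_mem i) (D.seg_fst_mem j) (D.seg_snd_mem j)
    (D.edge_ne i) (D.seg_fst_ne hne.symm) (D.seg_fst_ne_snd j i)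
    (D.seg_fst_ne_snd i j).symm (D.seg_snd_ne hne.symm)).2 h

/-- The line through the word segment `W_k`, parametrized so that the segment is run through
on `[0, 1]`. -/
noncomputable def segLine (k : ℤ) (s : ℝ) : ℝ × ℝ :=
  AffineMap.lineMap (R.place (D.seg k).1) (R.place (D.seg k).2) s

theorem point_eq {k : ℤ} {t : ℝ} (ht : t ∈ Ico (k : ℝ) (k + 1)) :
    (R.point t : ℝ × ℝ) = R.segLine k (t - k) := by
  have h1 : ⌊t⌋ = k := Int.floor_eq_iff.2 ht
  have h2 : Int.fract t = t - k := by rw [← Int.self_sub_floor, h1]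
  simp only [point, segLine, h1, h2]

/-- At the right end the floor jumps to the next segment; the two values agree because its initial
point is glued to the final point of `W_k`. -/
theorem curve_eq {k : ℤ} {t : ℝ} (ht : t ∈ Icc (k : ℝ) (k + 1)) :
    R.curve (t : AddCircle (n : ℝ)) = surfacePt D.X R.Q (R.segLine k (t - k)) := by
  have key : ∀ {k : ℤ} {t : ℝ}, t ∈ Ico (k : ℝ) (k + 1) →
      R.curve (t : AddCircle (n : ℝ)) = surfacePt D.X R.Q (R.segLine k (t - k)) := by
    intro k t ht
    rw [← R.point_eq ht, surfacePt, R.Q.toRegion_of_mem (R.point t).2]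
    rfl
  rcases ht.2.lt_or_eq with h | h
  · exact key ⟨ht.1, h⟩
  · have ht' : t ∈ Ico ((k + 1 : ℤ) : ℝ) ((k + 1 : ℤ) + 1) := by
      rw [h]; push_cast; constructor <;> linarith
    rw [key ht', h, segLine, segLine]
    push_cast
    rw [sub_self, add_sub_cancel_left, AffineMap.lineMap_apply_zero, AffineMap.lineMap_apply_one,
      D.seg_succ_fst, R.place_inv (D.seg_snd_mem k), place]
    exact (surfacePt_edgePt D.X R.Q _ (R.pos_mem_Icc (D.seg_snd_mem k))).symm

theorem exists_crossing_time {i j : ℤ} (h : D.Crosses i j) :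
    ∃ a ∈ Ioo (i : ℝ) (i + 1), ∃ c ∈ Ioo (j : ℝ) (j + 1), R.point a = R.point c := by
  obtain ⟨s, hs, t, ht, e⟩ := exists_crossing (R.orient_mul_neg h) (R.orient_mul_neg h.symm)
  have ha : i + s ∈ Ioo (i : ℝ) (i + 1) := ⟨by linarith [hs.1], by linarith [hs.2]⟩
  have hc : j + t ∈ Ioo (j : ℝ) (j + 1) := ⟨by linarith [ht.1], by linarith [ht.2]⟩
  refine ⟨_, ha, _, hc, Subtype.ext ?_⟩
  rw [R.point_eq (Ioo_subset_Ico_self ha), R.point_eq (Ioo_subset_Ico_self hc),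
    add_sub_cancel_left, add_sub_cancel_left]
  exact e

/-! ### The legs of a combinatorial bigon -/

/-- The leg that starts with `W_l` and runs forwards or in reverse. -/
noncomputable def leg (rev : Bool) (l : ℤ) (x : ℕ → Letter g) (L : ℕ)
    (hx : ∀ m : ℕ, m + 1 < L → x m = (exitPt rev (D.seg (legIdx rev l m))).1) :
    Leg D.X R.Q x L where
  start m := R.place (entryPt rev (D.seg (legIdx rev l m)))
  final m := R.place (exitPt rev (D.seg (legIdx rev l m)))
  u m := R.pos (exitPt rev (D.seg (legIdx rev l m)))
  start_mem m := R.place_mem (D.entryPt_mem rev _)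
  final_mem m := R.place_mem (D.exitPt_mem rev _)
  u_mem m := R.pos_mem_Icc (D.exitPt_mem rev _)
  final_eq m hm := by rw [hx m hm]; rfl
  start_eq m hm := by
    rw [Nat.cast_add, Nat.cast_one, D.entryPt_succ, R.place_inv (D.exitPt_mem rev _), hx m hm]

/-- The time on the leg that starts with `W_l` that corresponds to the time `t` on the circle. -/
def legClock (rev : Bool) (l : ℤ) (t : ℝ) : ℝ := if rev then l + 1 - t else t - l

theorem legClock_mem_iff (rev : Bool) (l : ℤ) (m : ℕ) (t : ℝ) :
    legClock rev l t ∈ Icc (m : ℝ) (m + 1) ↔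
      t ∈ Icc (legIdx rev l m : ℝ) (legIdx rev l m + 1) := by
  cases rev <;> simp [legClock, legIdx] <;> constructor <;> rintro ⟨h1, h2⟩ <;> constructor <;>
    linarith

theorem legClock_mem_Ioo (rev : Bool) (l : ℤ) (m : ℕ) {t : ℝ}
    (h : t ∈ Ioo (legIdx rev l m : ℝ) (legIdx rev l m + 1)) :
    legClock rev l t ∈ Ioo (m : ℝ) (m + 1) := by
  cases rev <;> simp [legClock, legIdx] at h ⊢ <;> constructor <;> linarith

theorem image_legClock (rev : Bool) (l : ℤ) (c d : ℝ) :
    legClock rev l '' uIcc c d = uIcc (legClock rev l c) (legClock rev l d) := by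
  cases rev
  · exact image_sub_const_uIcc _ _ _
  · exact image_const_sub_uIcc _ _ _

theorem continuous_legClock (rev : Bool) (l : ℤ) : Continuous (legClock rev l) := by
  cases rev
  · exact continuous_id.sub continuous_const
  · exact continuous_const.sub continuous_id

/-- In reverse, the exchange of the endpoints and the backward clock `l + 1 - t` cancel. -/
theorem leg_segPt (rev : Bool) (l : ℤ) {x : ℕ → Letter g} {L : ℕ} (hx) (m : ℕ) (t : ℝ) :
    (R.leg rev l x L hx).segPt m (legClock rev l t) =
      R.segLine (legIdx rev l m) (t - legIdx rev l m) := by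
  cases rev
  · simp only [Leg.segPt, leg, legClock, entryPt, exitPt, segLine, legIdx, Bool.false_eq_true,
      if_false]
    congr 1
    push_cast; ring
  · simp only [Leg.segPt, leg, legClock, entryPt, exitPt, segLine, legIdx, if_true]
    rw [← AffineMap.lineMap_apply_one_sub]
    congr 1
    push_cast; ring

theorem proj_leg_path (rev : Bool) (l : ℤ) {x : ℕ → Letter g} {L : ℕ} (hx) (hL : 0 < L) {t : ℝ}
    (ht : legClock rev l t ∈ Icc (0 : ℝ) L) :
    UnivCover.proj D.X R.Q ((R.leg rev l x L hx).path (legClock rev l t)) =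
      R.curve (t : AddCircle (n : ℝ)) := by
  obtain ⟨m, hm, h⟩ := exists_mem_Icc_nat hL ht
  rw [Leg.path_eq _ hm h, proj_cell, R.leg_segPt,
    R.curve_eq ((legClock_mem_iff rev l m t).1 h)]

end SegRep

theorem CurveCode.forward_exit {g n : ℕ} (D : CurveCode g n) (k : ℤ) (L : ℕ) (m : ℕ)
    (_ : m + 1 < L) : (D.seg (k + m)).2.1 = (exitPt false (D.seg (legIdx false k m))).1 := rfl

namespace CurveCode.IsCombBigon

variable {g n : ℕ} {D : CurveCode g n} {rev : Bool} {k l : ℤ} {L : ℕ}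

theorem cast_pred (hB : D.IsCombBigon rev k l L) : ((L - 1 : ℕ) : ℤ) = (L : ℤ) - 1 := by
  have := hB.two_le
  omega

/-- Segments at the same place of the two legs are different. -/
theorem seg_ne (hB : D.IsCombBigon rev k l L) {m : ℕ} (hm : m + 1 < L) :
    D.seg (k + m) ≠ D.seg (legIdx rev l m) := by
  intro e
  cases rev
  -- For equal orientations the index difference is constant along the legs, so equality at one
  -- place would give `W_k = W_l`.
  · apply hB.first.seg_ne
    rw [D.seg_eq_iff] at e ⊢
    simpa [legIdx] using e
  -- A segment traced in both directions would leave through the edges of both its endpoints, and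
  -- these edges differ.
  · have h := hB.nosplit m hm
    rw [e] at h
    exact D.edge_ne _ h.symm

/-- The legs cross each common edge at different points, which keeps the triangles and
quadrilaterals nondegenerate. -/
theorem exitPt_ne (hB : D.IsCombBigon rev k l L) {m : ℕ} (hm : m + 1 < L) :
    (D.seg (k + m)).2 ≠ exitPt rev (D.seg (legIdx rev l m)) := by
  have h := hB.seg_ne hm
  cases rev
  · exact D.seg_snd_ne h
  · exact (D.seg_fst_ne_snd _ _).symm

end CurveCode.IsCombBigon

/-! ### From combinatorial bigons to embedded strips -/

namespace SegRep

variable {g n : ℕ} {D : CurveCode g n} (R : SegRep D) {rev : Bool} {k l : ℤ} {L : ℕ}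

theorem exists_traces (hB : D.IsCombBigon rev k l L) :
    ∃ a b c d : ℝ, R.Traces rev k l L a b c d := by
  obtain ⟨a, ha, c, hc, e⟩ := R.exists_crossing_time hB.first
  obtain ⟨b, hb, d, hd, e'⟩ := R.exists_crossing_time hB.last
  exact ⟨a, b, c, d, ⟨ha, hb, hc, hd, e, e'⟩⟩

variable {R} {a b c d : ℝ}

theorem Traces.segLine_first (hT : R.Traces rev k l L a b c d) :
    R.segLine k (a - k) = R.segLine l (c - l) := by
  rw [← R.point_eq (Ioo_subset_Ico_self hT.a_mem), ← R.point_eq (Ioo_subset_Ico_self hT.c_mem),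
    hT.first]

theorem Traces.segLine_last (hT : R.Traces rev k l L a b c d) {i j : ℤ}
    (hi : i = k + ((L : ℤ) - 1)) (hj : j = legIdx rev l ((L : ℤ) - 1)) :
    R.segLine i (b - i) = R.segLine j (d - j) := by
  subst hi hj
  rw [← R.point_eq (Ioo_subset_Ico_self hT.b_mem), ← R.point_eq (Ioo_subset_Ico_self hT.d_mem),
    hT.last]

/-- The strip in the universal cover swept out between the legs of a combinatorial bigon. -/
noncomputable def Traces.strip (hT : R.Traces rev k l L a b c d)
    (hB : D.IsCombBigon rev k l L) :
    Strip D.X R.Q (fun m => (D.seg (k + m)).2.1) L where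
  A := R.leg false k _ L (D.forward_exit k L)
  B := R.leg rev l _ L hB.nosplit
  α := legClock false k a
  β := legClock false k b
  α' := legClock rev l c
  β' := legClock rev l d
  two_le := hB.two_le
  reduced m _ := by
    have h := D.reduced ((k + m : ℤ) : ZMod n)
    rw [← D.word, ← D.word] at h
    simpa [CurveCode.seg, add_assoc] using h
  u_ne m hm := R.pos_ne (D.seg_snd_mem _) (D.exitPt_mem _ _) (hB.nosplit m hm) (hB.exitPt_ne hm)
  α_mem := by
    have := legClock_mem_Ioo false k 0 (t := a) (by simpa [legIdx] using hT.a_mem)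
    simpa using this
  α'_mem := by
    have := legClock_mem_Ioo rev l 0 (t := c) (by simpa [legIdx] using hT.c_mem)
    simpa using this
  β_mem := by
    have := legClock_mem_Ioo false k (L - 1) (t := b) (by rw [hB.cast_pred]; exact hT.b_mem)
    have e : ((L - 1 : ℕ) : ℝ) = L - 1 := by
      exact_mod_cast congrArg (Int.cast (R := ℝ)) hB.cast_pred
    rw [e, sub_add_cancel] at this
    exact this
  β'_mem := by
    have := legClock_mem_Ioo rev l (L - 1) (t := d) (by rw [hB.cast_pred]; exact hT.d_mem)
    have e : ((L - 1 : ℕ) : ℝ) = L - 1 := by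
      exact_mod_cast congrArg (Int.cast (R := ℝ)) hB.cast_pred
    rw [e, sub_add_cancel] at this
    exact this
  first := by
    rw [R.leg_segPt, R.leg_segPt, Nat.cast_zero, legIdx_zero, legIdx_zero]
    exact hT.segLine_first
  last := by
    rw [R.leg_segPt, R.leg_segPt, hB.cast_pred]
    exact hT.segLine_last rfl rfl
  side_first := by
    have h := edgeSide_neg (X := D.X) R.Q (D.edge_ne k).symm (R.pos_mem_Icc (D.seg_fst_mem k))
    simpa [leg, entryPt, legIdx, place] using h
  side_last := by
    have h2 := hB.two_le
    have h := edgeSide_neg (X := D.X) R.Q (D.edge_ne (k + (L - 1 : ℕ)))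
      (R.pos_mem_Icc (D.seg_snd_mem (k + (L - 1 : ℕ))))
    have e : (k + (L - 1 : ℕ) : ℤ) = k + (L - 2 : ℕ) + 1 := by omega
    have e1 : (D.seg (k + (L - 1 : ℕ))).1.1 = (D.seg (k + (L - 2 : ℕ))).2.1.inv := by
      rw [e, D.seg_succ_fst]; rfl
    rw [e1] at h
    exact h
  noncross m h0 hm := by
    have h := R.orient_mul_pos (hB.seg_ne hm) (hB.mid m h0 hm)
    cases rev
    · exact h
    · rw [mul_comm]; exact h
  noncross' m h0 hm := by
    have h := R.orient_mul_pos (hB.seg_ne hm).symm fun h => hB.mid m h0 hm h.symm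
    cases rev
    · exact h
    -- Reversing the second leg changes the sign of both factors and hence not their product.
    · simp only [leg, entryPt, exitPt, if_true, orient_swap (R.place (D.seg (legIdx true l m)).1),
        neg_mul_neg]
      exact h

theorem Traces.isBigon (hT : R.Traces rev k l L a b c d) (hB : D.IsCombBigon rev k l L) :
    R.IsBigon a b c d := by
  let S := hT.strip hB
  have hL := hB.two_le
  have hL' : (2 : ℝ) ≤ L := by exact_mod_cast hL
  have hn : (L : ℝ) ≤ n := by exact_mod_cast hB.le
  have hα : legClock false k a ∈ Ioo (0 : ℝ) 1 := S.α_mem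
  have hβ : legClock false k b ∈ Ioo ((L : ℝ) - 1) L := S.β_mem
  have hα' : legClock rev l c ∈ Ioo (0 : ℝ) 1 := S.α'_mem
  have hβ' : legClock rev l d ∈ Ioo ((L : ℝ) - 1) L := S.β'_mem
  have hAB : uIcc (legClock false k a) (legClock false k b) = Icc S.α S.β :=
    uIcc_of_le (by linarith [hα.2, hβ.1])
  have hCD : uIcc (legClock rev l c) (legClock rev l d) = Icc S.α' S.β' :=
    uIcc_of_le (by linarith [hα'.2, hβ'.1])
  have hab : ∀ t ∈ uIcc a b, legClock false k t ∈ Icc (0 : ℝ) L := by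
    intro t ht
    have h := mem_image_of_mem (legClock false k) ht
    rw [image_legClock, hAB] at h
    exact ⟨hα.1.le.trans h.1, h.2.trans hβ.2.le⟩
  have hcd : ∀ t ∈ uIcc c d, legClock rev l t ∈ Icc (0 : ℝ) L := by
    intro t ht
    have h := mem_image_of_mem (legClock rev l) ht
    rw [image_legClock, hCD] at h
    exact ⟨hα'.1.le.trans h.1, h.2.trans hβ'.2.le⟩
  have hγ : ∀ t ∈ uIcc a b, UnivCover.proj D.X R.Q (S.A.path (legClock false k t)) =
      R.curve (t : AddCircle (n : ℝ)) := fun t ht =>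
    R.proj_leg_path false k (D.forward_exit k L) (by omega) (hab t ht)
  have hδ : ∀ t ∈ uIcc c d, UnivCover.proj D.X R.Q (S.B.path (legClock rev l t)) =
      R.curve (t : AddCircle (n : ℝ)) := fun t ht =>
    R.proj_leg_path rev l hB.nosplit (by omega) (hcd t ht)
  -- The clock starts in `(0, 1)` and ends in `(L - 1, L)`, so with `2 ≤ L ≤ n` an arc is nontrivial
  -- and shorter than the circle.
  have dist : ∀ (rev : Bool) (l : ℤ) (c d : ℝ), legClock rev l c ∈ Ioo (0 : ℝ) 1 →
      legClock rev l d ∈ Ioo ((L : ℝ) - 1) L → c ≠ d ∧ |d - c| < n := by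
    intro rev l c d hc hd
    cases rev <;> simp only [legClock, Bool.false_eq_true, if_false, if_true, mem_Ioo] at hc hd
    · exact ⟨fun h => by subst h; linarith, by rw [abs_lt]; constructor <;> linarith⟩
    · exact ⟨fun h => by subst h; linarith, by rw [abs_lt]; constructor <;> linarith⟩
  have hfirst : S.A.path (legClock false k a) = S.B.path (legClock rev l c) := by
    rw [S.A.path_eq (m := 0) (by omega), S.B.path_eq (m := 0) (by omega)]
    · exact congrArg _ S.first
    · simpa using Ioo_subset_Icc_self hα'
    · simpa using Ioo_subset_Icc_self hα
  have hlast : S.A.path (legClock false k b) = S.B.path (legClock rev l d) := by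
    rw [S.A.path_eq (m := L - 1) (by omega), S.B.path_eq (m := L - 1) (by omega)]
    · exact congrArg _ S.last
    · rw [S.cast_pred, sub_add_cancel]; exact Ioo_subset_Icc_self hβ'
    · rw [S.cast_pred, sub_add_cancel]; exact Ioo_subset_Icc_self hβ
  refine ⟨dist _ _ _ _ hα hβ, dist _ _ _ _ hα' hβ', ?_, ?_,
    fun t => S.A.path (legClock false k t), fun t => S.B.path (legClock rev l t),
    ?_, hγ, ?_, hδ, hfirst, hlast, ?_⟩
  · rw [← hγ a left_mem_uIcc, ← hδ c left_mem_uIcc, hfirst]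
  · rw [← hγ b right_mem_uIcc, ← hδ d right_mem_uIcc, hlast]
  · exact (S.A.continuousOn_path (by omega)).comp (continuous_legClock _ _).continuousOn hab
  · exact (S.B.continuousOn_path (by omega)).comp (continuous_legClock _ _).continuousOn hcd
  · obtain ⟨φ, h1, h2, h3⟩ := S.exists_disk
    refine ⟨φ, h1, h2, ?_⟩
    rw [h3, ← hAB, ← hCD, ← image_legClock, ← image_legClock, image_image, image_image]

/-! ### Overlapping arcs -/

/-- Equal segments have indices congruent modulo `n`, so equal offsets in them are the same point of
the circle. -/
theorem not_disjoint_circleArc {t t' : ℝ} {p q : ℤ} (ht : t ∈ uIcc a b) (ht' : t' ∈ uIcc c d)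
    (h : D.seg p = D.seg q) (e : t - p = t' - q) :
    ¬ Disjoint (circleArc n a b) (circleArc n c d) := by
  rw [not_disjoint_iff]
  refine ⟨t, ⟨t, ht, rfl⟩, ⟨t', ht', ?_⟩⟩
  rw [D.seg_eq_iff, ZMod.intCast_eq_intCast_iff_dvd_sub] at h
  obtain ⟨z, hz⟩ := h
  show (t' : AddCircle (n : ℝ)) = t
  rw [← sub_eq_zero, ← AddCircle.coe_sub, AddCircle.coe_eq_zero_iff]
  refine ⟨z, ?_⟩
  have hz' : (q : ℝ) - p = n * z := by exact_mod_cast hz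
  rw [zsmul_eq_mul]
  linarith

/-- A leg contains all of its segments but the first and the last one. -/
theorem Icc_subset_leg (hc : c ∈ Ioo (l : ℝ) (l + 1))
    (hd : d ∈ Ioo ((legIdx rev l ((L : ℤ) - 1) : ℤ) : ℝ) ((legIdx rev l ((L : ℤ) - 1) : ℤ) + 1))
    {m : ℕ} (h0 : 0 < m) (hm : m + 1 < L) :
    Icc (legIdx rev l m : ℝ) (legIdx rev l m + 1) ⊆ uIcc c d := by
  intro t ht
  have h0' : (1 : ℝ) ≤ m := by exact_mod_cast h0
  have hm' : (m : ℝ) + 2 ≤ L := by exact_mod_cast hm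
  rw [mem_uIcc]
  cases rev <;> simp [legIdx] at hd ht
  · left; constructor <;> linarith [hc.2]
  · right; constructor <;> linarith [hc.1]

/-- A leg contains a time at each of its segments. -/
theorem exists_mem_leg (hc : c ∈ Ioo (l : ℝ) (l + 1))
    (hd : d ∈ Ioo ((legIdx rev l ((L : ℤ) - 1) : ℤ) : ℝ) ((legIdx rev l ((L : ℤ) - 1) : ℤ) + 1))
    {m : ℕ} (hm : m < L) :
    ∃ t ∈ uIcc c d, t ∈ Icc (legIdx rev l m : ℝ) (legIdx rev l m + 1) := by
  rcases (show m = 0 ∨ m + 1 = L ∨ (0 < m ∧ m + 1 < L) by omega) with h | h | ⟨h, h'⟩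
  · subst h
    refine ⟨c, left_mem_uIcc, ?_⟩
    rw [Nat.cast_zero, legIdx_zero]
    exact Ioo_subset_Icc_self hc
  · refine ⟨d, right_mem_uIcc, ?_⟩
    rw [show (m : ℤ) = (L : ℤ) - 1 by omega]
    exact Ioo_subset_Icc_self hd
  · have hmem : (legIdx rev l m : ℝ) ∈ Icc (legIdx rev l m : ℝ) (legIdx rev l m + 1) := by simp
    exact ⟨_, Icc_subset_leg hc hd h h' hmem, hmem⟩

/-- The arcs overlap if they share a segment that is not at the end of both legs. -/
theorem Traces.not_disjoint_of_shared (hT : R.Traces rev k l L a b c d) {m m' : ℕ} (hm : m < L)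
    (hm' : m' < L) (h : D.seg (k + m) = D.seg (legIdx rev l m'))
    (hmid : (0 < m ∧ m + 1 < L) ∨ (0 < m' ∧ m' + 1 < L)) :
    ¬ Disjoint (circleArc n a b) (circleArc n c d) := by
  rcases hmid with ⟨h0, h1⟩ | ⟨h0, h1⟩
  · obtain ⟨t, ht, ht'⟩ := exists_mem_leg hT.c_mem hT.d_mem hm'
    refine not_disjoint_circleArc (t := t - legIdx rev l m' + (k + m : ℤ))
      (Icc_subset_leg (rev := false) hT.a_mem hT.b_mem h0 h1 ?_) ht h (by ring)
    rw [show legIdx false k m = k + m from rfl]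
    constructor <;> linarith [ht'.1, ht'.2]
  · obtain ⟨t, ht, ht'⟩ := exists_mem_leg (rev := false) hT.a_mem hT.b_mem hm
    simp only [legIdx, Bool.false_eq_true, if_false] at ht'
    refine not_disjoint_circleArc (t' := t - (k + m : ℤ) + legIdx rev l m') ht
      (Icc_subset_leg hT.c_mem hT.d_mem h0 h1 ?_) h (by ring)
    constructor <;> linarith [ht'.1, ht'.2]

/-- Disjoint arcs allow a shared segment only as the first of one leg and the last of the other. Two
of these force `W_k = W_j` and `W_i = W_l`, and uniqueness of the crossing makes `a` and `d` the
same point of the circle. -/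
theorem Traces.not_disjoint_of_two_le_card (hT : R.Traces rev k l L a b c d)
    (hB : D.IsCombBigon rev k l L) (h : 2 ≤ (D.shared rev k l L).card) :
    ¬ Disjoint (circleArc n a b) (circleArc n c d) := by
  have hL := hB.two_le
  by_contra hdis
  have key : ∀ s ∈ D.shared rev k l L,
      (s = D.seg k ∧ s = D.seg (legIdx rev l ((L : ℤ) - 1))) ∨
      (s = D.seg (k + ((L : ℤ) - 1)) ∧ s = D.seg l) := by
    intro s hs
    simp only [CurveCode.shared, Finset.mem_inter, Finset.mem_image, Finset.mem_range] at hs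
    obtain ⟨⟨m, hm, e⟩, ⟨m', hm', e'⟩⟩ := hs
    have hmid : ¬ ((0 < m ∧ m + 1 < L) ∨ (0 < m' ∧ m' + 1 < L)) := fun hmid =>
      hT.not_disjoint_of_shared hm hm' (e.trans e'.symm) hmid hdis
    -- A shared segment cannot be first in both legs or last in both, since the segments in these
    -- places cross and so are different.
    have c1 : (m = 0 ∧ m' = 0) ∨ (m = 0 ∧ (m' : ℤ) = (L : ℤ) - 1) ∨
        ((m : ℤ) = (L : ℤ) - 1 ∧ m' = 0) ∨ ((m : ℤ) = (L : ℤ) - 1 ∧ (m' : ℤ) = (L : ℤ) - 1) := by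
      omega
    rcases c1 with ⟨h1, h2⟩ | ⟨h1, h2⟩ | ⟨h1, h2⟩ | ⟨h1, h2⟩ <;> simp only [h1, h2] at e e'
    · rw [Nat.cast_zero, add_zero] at e
      rw [Nat.cast_zero, legIdx_zero] at e'
      exact absurd (e.trans e'.symm) hB.first.seg_ne
    · rw [Nat.cast_zero, add_zero] at e
      exact Or.inl ⟨e.symm, e'.symm⟩
    · rw [Nat.cast_zero, legIdx_zero] at e'
      exact Or.inr ⟨e.symm, e'.symm⟩
    · exact absurd (e.trans e'.symm) hB.last.seg_ne
  obtain ⟨s, hs, s', hs', hne⟩ := Finset.one_lt_card.1 h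
  have hends : D.seg k = D.seg (legIdx rev l ((L : ℤ) - 1)) ∧
      D.seg (k + ((L : ℤ) - 1)) = D.seg l := by
    rcases key s hs with ⟨h1, h2⟩ | ⟨h1, h2⟩ <;> rcases key s' hs' with ⟨h3, h4⟩ | ⟨h3, h4⟩
    · exact absurd (h1.trans h3.symm) hne
    · exact ⟨h1.symm.trans h2, h3.symm.trans h4⟩
    · exact ⟨h3.symm.trans h4, h1.symm.trans h2⟩
    · exact absurd (h1.trans h3.symm) hne
  have e1 := hT.segLine_first
  have e2 := hT.segLine_last rfl rfl
  simp only [segLine, hends.2, ← hends.1] at e1 e2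
  obtain ⟨h1, -⟩ := crossing_unique (R.orient_mul_neg hB.first) e1 e2.symm
  exact not_disjoint_circleArc left_mem_uIcc right_mem_uIcc hends.1 h1 hdis

theorem Traces.not_disjoint_of_between (hT : R.Traces rev k l L a b c d)
    (hB : D.IsCombBigon rev k l L) {i j : ℤ} (hi : i = k + ((L : ℤ) - 1))
    (hj : j = legIdx rev l ((L : ℤ) - 1)) (hkj : D.seg k = D.seg j)
    (h₁ : D.Between (D.seg i).1 (D.seg k).1 (D.seg l).1)
    (h₂ : D.Between (D.seg l).2 (D.seg k).2 (D.seg i).2) :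
    ¬ Disjoint (circleArc n a b) (circleArc n c d) := by
  have hL := hB.two_le
  have hL' : (2 : ℝ) ≤ L := by exact_mod_cast hL
  have ha := hT.a_mem
  have hb := hT.b_mem
  have hc := hT.c_mem
  have hd := hT.d_mem
  rw [← hi] at hb
  rw [← hj] at hd
  have hi' : (i : ℝ) = k + (L - 1) := by rw [hi]; push_cast; ring
  cases rev
  · have hj' : (j : ℝ) = l + (L - 1) := by rw [hj]; simp [legIdx]
    have hs := hB.nosplit (L - 2) (by omega)
    have ei : i = k + (L - 2 : ℕ) + 1 := by omega
    have ej : j = l + (L - 2 : ℕ) + 1 := by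
      simp only [legIdx, Bool.false_eq_true, if_false] at hj; omega
    -- The legs leave the next-to-last cell through a common edge, so `W_i` and `W_j = W_k` enter
    -- through the same one.
    have e₁ : (D.seg i).1.1 = (D.seg k).1.1 := by
      rw [hkj, ei, ej, D.seg_succ_fst, D.seg_succ_fst]
      exact congrArg Letter.inv hs
    have e₂ : (D.seg l).2.1 = (D.seg k).2.1 := by
      have := hB.nosplit 0 (by omega)
      simpa [exitPt, legIdx] using this.symm
    have f₁ := h₁.edge_eq (D.seg_fst_mem i) (D.seg_fst_mem k) (D.seg_fst_mem l) e₁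
    have f₂ := h₂.edge_eq (D.seg_snd_mem l) (D.seg_snd_mem k) (D.seg_snd_mem i) e₂
    have c₁ := hT.segLine_first
    have c₂ := (hT.segLine_last hi hj).symm
    simp only [segLine, ← hkj, place, e₁, e₂, f₁, f₂] at c₁ c₂
    -- Relative to `W_k`, the chord `W_l` starts closer and ends farther away than `W_i`, so it is
    -- crossed first.
    have hlt := crossing_order R.Q (D.edge_ne k) (R.pos_mem_Icc (D.seg_fst_mem k))
      (R.pos_mem_Icc (D.seg_fst_mem l)) (R.pos_mem_Icc (D.seg_fst_mem i))
      (R.pos_mem_Icc (D.seg_snd_mem k)) (R.pos_mem_Icc (D.seg_snd_mem l))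
      (R.pos_mem_Icc (D.seg_snd_mem i))
      (R.pos_between (D.seg_fst_mem i) (D.seg_fst_mem k) (D.seg_fst_mem l) e₁ h₁)
      (R.pos_between (D.seg_snd_mem l) (D.seg_snd_mem k) (D.seg_snd_mem i) e₂ h₂)
      ⟨by linarith [ha.1], by linarith [ha.2]⟩ ⟨by linarith [hd.1], by linarith [hd.2]⟩ c₁ c₂
    -- The crossing at time `d`, moved from `W_j` to `W_k`, comes after `a` and within `W_k`, hence
    -- before `b`.
    refine not_disjoint_circleArc (t := k + (d - j)) (t' := d) ?_ right_mem_uIcc hkj (by ring)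
    rw [mem_uIcc]
    left
    constructor <;> linarith [hb.1, hd.2]
  -- The reversed leg enters `W_j` at its final point, and the first leg leaves `W_k` there; as `L ≥
  -- 2`, both arcs contain this point.
  · have hj' : (j : ℝ) = l - (L - 1) := by rw [hj]; simp [legIdx]
    refine not_disjoint_circleArc (t := k + 1) (t' := j + 1) ?_ ?_ hkj (by ring)
    · rw [mem_uIcc]; left; constructor <;> linarith [ha.2, hb.1]
    · rw [mem_uIcc]; right; constructor <;> linarith [hd.2, hc.1]

end SegRep

theorem mainTheorem3 {g n : ℕ} [NeZero n] (D : CurveCode g n) (rev : Bool) (k l i j : ℤ) (L : ℕ)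
    (hi : i = k + ((L : ℤ) - 1)) (hj : j = legIdx rev l ((L : ℤ) - 1))
    (hB : D.IsCombBigon rev k l L)
    (hcond : 2 ≤ (D.shared rev k l L).card ∨
      ((D.shared rev k l L).card = 1 ∧ D.seg k = D.seg j ∧
        D.Between (D.seg i).1 (D.seg k).1 (D.seg l).1 ∧
        D.Between (D.seg l).2 (D.seg k).2 (D.seg i).2))
    (R : SegRep D) :
    (∃ a b c d : ℝ, R.Traces rev k l L a b c d) ∧
      ∀ a b c d : ℝ, R.Traces rev k l L a b c d → R.IsImproperBigon a b c d := by
  refine ⟨R.exists_traces hB, fun a b c d hT => ⟨hT.isBigon hB, ?_⟩⟩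
  rcases hcond with h | ⟨-, hkj, h₁, h₂⟩
  · exact hT.not_disjoint_of_two_le_card hB h
  · exact hT.not_disjoint_of_between hB hi hj hkj h₁ h₂
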